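/- Let $n\ge 1$ be an integer, $\alpha\in(n-1,n)$, $\lambda\ge 0$. For a non-integer $\beta>0$ with $N-1<\beta<N$, $N\in\mathbb N^+$, the left and right Riemann--Liouville tempered fractional derivatives of $u$ are $$ {}_{-\infty}D_x^{\beta,\lambda}u(x)=\frac{e^{-\lambda x}}{\Gamma(N-\beta)}\frac{d^N}{dx^N}\int_{-\infty}^x\frac{e^{\lambda\xi}u(\xi)}{(x-\xi)^{\beta-N+1}}\,d\xi,\qquad {}_{x}D_{+\infty}^{\beta,\lambda}u(x)=\frac{(-1)^Ne^{\lambda x}}{\Gamma(N-\beta)}\frac{d^N}{dx^N}\int_x^{+\infty}\frac{e^{-\lambda\xi}u(\xi)}{(\xi-x)^{\beta-N+1}}\,d\xi . $$ Such a derivative is said to exist almost everywhere if the integral converges absolutely for every $x$ and is an $(N-1)$-times continuously differentiable function of $x$ whose $(N-1)$-st derivative is locally absolutely continuous. With $w_k^{(\alpha)}=(-1)^k\binom{\alpha}{k}$, $h>0$ and $p\in\mathbb R$, define the shifted tempered Gr\"unwald operators $$ A^{\alpha,\lambda}_{h,p}u(x)=\frac1{h^\alpha}\sum_{k=0}^{\infty}w_k^{(\alpha)}e^{-(k-p)h\lambda}u(x-(k-p)h)-\frac{1}{h^\alpha}e^{ph\lambda}(1-e^{-h\lambda})^\alpha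 u(x), $$ $$ B^{\alpha,\lambda}_{h,p}u(x)=\frac1{h^\alpha}\sum_{k=0}^{\infty}w_k^{(\alpha)}e^{-(k-p)h\lambda}u(x+(k-p)h)-\frac{1}{h^\alpha}e^{ph\lambda}(1-e^{-h\lambda})^\alpha u(x). $$ Put $$ \begin{aligned} c_0(p)&=1,\qquad c_1(p)=p-\tfrac{\alpha}{2},\qquad c_2(p)=\tfrac{p^2}{2}-\tfrac{\alpha p}{2}+\tfrac{\alpha}{6}+\tfrac{\alpha(\alpha-1)}{8},\\ c_3(p)&=\tfrac{p^3}{6}-\tfrac{\alpha p^2}{4}+\big(\tfrac{\alpha}{6}+\tfrac{\alpha(\alpha-1)}{8}\big)p-\tfrac{\alpha}{24}-\tfrac{\alpha(\alpha-1)}{12}-\tfrac{\alpha(\alpha-1)(\alpha-2)}{48},\\ c_4(p)&=\tfrac{p^4}{24}-\tfrac{\alpha p^3}{12}+\tfrac12\big(\tfrac{\alpha}{6}+\tfrac{\alpha(\alpha-1)}{8}\big)p^2+\big(-\tfrac{\alpha}{24}-\tfrac{\alpha(\alpha-1)}{12}-\tfrac{\alpha(\alpha-1)(\alpha-2)}{48}\big)p\\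 &\quad+\tfrac{\alpha}{120}+\tfrac{5\alpha(\alpha-1)}{144}+\tfrac{\alpha(\alpha-1)(\alpha-2)}{48}+\tfrac{\alpha(\alpha-1)(\alpha-2)(\alpha-3)}{384}. \end{aligned} $$ Let $\ell\in\{2,3,4,5\}$, let $m\ge\ell$ be an integer, and let $p_1,\dots,p_m,\gamma_1,\dots,\gamma_m\in\mathbb R$ satisfy $$\sum_{j=1}^m\gamma_j=1,\qquad \sum_{j=1}^m\gamma_j\,c_i(p_j)=0\quad(1\le i\le \ell-1).$$ Let $u:\mathbb R\to\mathbb C$ be continuous with $u\in L^1(\mathbb R)$. (Left) If ${}_{-\infty}D_x^{\alpha+\ell,\lambda}u$ exists almost everywhere and both it and its Fourier transform belong to $L^1(\mathbb R)$, then ${}_{-\infty}D_x^{\alpha,\lambda}u$ exists everywhere as a continuous function, the series defining $A^{\alpha,\lambda}_{h,p_j}u(x)$ converge absolutely for all $h>0$ and $x\in\mathbb R$, and, as $h\to0^+$, $$\sum_{j=1}^m\gamma_jA^{\alpha,\lambda}_{h,p_j}u(x)={}_{-\infty}D_x^{\alpha,\lambda}u(x)-\lambda^\alpha u(x)+O(h^\ell)\quad\text{uniformly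 for }x\in\mathbb R.$$ (Right) If ${}_{x}D_{+\infty}^{\alpha+\ell,\lambda}u$ exists almost everywhere and both it and its Fourier transform belong to $L^1(\mathbb R)$, then ${}_{x}D_{+\infty}^{\alpha,\lambda}u$ exists everywhere as a continuous function, the series defining $B^{\alpha,\lambda}_{h,p_j}u(x)$ converge absolutely for all $h>0$ and $x\in\mathbb R$, and, as $h\to0^+$, $$\sum_{j=1}^m\gamma_jB^{\alpha,\lambda}_{h,p_j}u(x)={}_{x}D_{+\infty}^{\alpha,\lambda}u(x)-\lambda^\alpha u(x)+O(h^\ell)\quad\text{uniformly for }x\in\mathbb R.$$ -/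

import Mathlib

open MeasureTheory Set
open scoped FourierTransform

noncomputable section

/-! ### Riemann–Liouville calculus on the whole line -/

/-- Left Riemann–Liouville integral of order `s` from `-∞`:
`(1 / Γ(s)) ∫_{-∞}^x (x - ξ)^(s - 1) f(ξ) dξ`. -/
def leftRLIntegral (s : ℝ) (f : ℝ → ℂ) (x : ℝ) : ℂ :=
  (1 / Real.Gamma s) • ∫ ξ in Iio x, (x - ξ) ^ (s - 1) • f ξ

/-- Right Riemann–Liouville integral of order `s` up to `+∞`:
`(1 / Γ(s)) ∫_x^∞ (ξ - x)^(s - 1) f(ξ) dξ`. -/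
def rightRLIntegral (s : ℝ) (f : ℝ → ℂ) (x : ℝ) : ℂ :=
  (1 / Real.Gamma s) • ∫ ξ in Ioi x, (ξ - x) ^ (s - 1) • f ξ

/-- The integer `N` with `N - 1 < β < N`, for a positive non-integer order `β`. -/
def rlDegree (β : ℝ) : ℕ := ⌊β⌋₊ + 1

/-- Left Riemann–Liouville derivative of order `β`, `N - 1 < β < N`:
`(d/dx)^N` of the left integral of order `N - β`. -/
def leftRLDeriv (β : ℝ) (f : ℝ → ℂ) (x : ℝ) : ℂ :=
  iteratedDeriv (rlDegree β) (leftRLIntegral (rlDegree β - β) f) x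

/-- Right Riemann–Liouville derivative of order `β`, `N - 1 < β < N`:
`(-1)^N (d/dx)^N` of the right integral of order `N - β`. -/
def rightRLDeriv (β : ℝ) (f : ℝ → ℂ) (x : ℝ) : ℂ :=
  (-1) ^ rlDegree β * iteratedDeriv (rlDegree β) (rightRLIntegral (rlDegree β - β) f) x

/-- The function `x ↦ e^{μ x} u(x)`. -/
def expWeight (μ : ℝ) (u : ℝ → ℂ) (x : ℝ) : ℂ := Real.exp (μ * x) • u x

/-- Left Riemann–Liouville tempered derivative `e^{-λx} D^β (e^{λ·} u)(x)`. -/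
def leftTemperedDeriv (β lam : ℝ) (u : ℝ → ℂ) (x : ℝ) : ℂ :=
  Real.exp (-lam * x) • leftRLDeriv β (expWeight lam u) x

/-- Right Riemann–Liouville tempered derivative `e^{λx} D^β (e^{-λ·} u)(x)`. -/
def rightTemperedDeriv (β lam : ℝ) (u : ℝ → ℂ) (x : ℝ) : ℂ :=
  Real.exp (lam * x) • rightRLDeriv β (expWeight (-lam) u) x

/-- `g` is `N - 1` times continuously differentiable and its `(N - 1)`-st derivative is locally
absolutely continuous, so that its `N`-th derivative exists almost everywhere, is locally
integrable, and satisfies the fundamental theorem of calculus (here `N = k + 1`). -/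
def HasLocallyIntegrableDeriv (k : ℕ) (g : ℝ → ℂ) : Prop :=
  ContDiff ℝ k g ∧ ∀ a b : ℝ, AbsolutelyContinuousOnInterval (iteratedDeriv k g) a b

/-- The left tempered derivative of order `β` exists as a locally integrable function
(defined almost everywhere): the singular integral in its definition converges absolutely for
every `x`, and it may be differentiated `N` times, the last time almost everywhere.
This holds in particular if `u` is integrable, `N - 1` times continuously differentiable, with
`u^{(N-1)}` locally absolutely continuous. -/
structure LeftTemperedDerivExistsAE (β lam : ℝ) (u : ℝ → ℂ) : Prop where
  integrable : ∀ x : ℝ,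
    IntegrableOn (fun ξ => (x - ξ) ^ ((rlDegree β - β) - 1) • expWeight lam u ξ) (Iio x)
  deriv : HasLocallyIntegrableDeriv ⌊β⌋₊ (leftRLIntegral (rlDegree β - β) (expWeight lam u))

/-- The right analogue of `LeftTemperedDerivExistsAE`. -/
structure RightTemperedDerivExistsAE (β lam : ℝ) (u : ℝ → ℂ) : Prop where
  integrable : ∀ x : ℝ,
    IntegrableOn (fun ξ => (ξ - x) ^ ((rlDegree β - β) - 1) • expWeight (-lam) u ξ) (Ioi x)
  deriv : HasLocallyIntegrableDeriv ⌊β⌋₊ (rightRLIntegral (rlDegree β - β) (expWeight (-lam) u))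

/-- The left tempered derivative of order `β` exists at every point, as a continuous function:
the singular integral converges absolutely and is `N` times continuously differentiable. -/
structure LeftTemperedDerivExists (β lam : ℝ) (u : ℝ → ℂ) : Prop where
  integrable : ∀ x : ℝ,
    IntegrableOn (fun ξ => (x - ξ) ^ ((rlDegree β - β) - 1) • expWeight lam u ξ) (Iio x)
  contDiff : ContDiff ℝ (rlDegree β) (leftRLIntegral (rlDegree β - β) (expWeight lam u))

/-- The right analogue of `LeftTemperedDerivExists`. -/
structure RightTemperedDerivExists (β lam : ℝ) (u : ℝ → ℂ) : Prop where
  integrable : ∀ x : ℝ,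
    IntegrableOn (fun ξ => (ξ - x) ^ ((rlDegree β - β) - 1) • expWeight (-lam) u ξ) (Ioi x)
  contDiff : ContDiff ℝ (rlDegree β) (rightRLIntegral (rlDegree β - β) (expWeight (-lam) u))

/-! ### Difference operators -/

/-- Normalized Grünwald weights `w_k = (-1)^k binom(α, k)`. -/
def grunwaldWeight (α : ℝ) (k : ℕ) : ℝ := (-1) ^ k * Ring.choose α k

/-- The `k`-th term `w_k e^{-(k-p)hλ} u(x - (k-p)h)` of the left shifted Grünwald series. -/
def leftGrunwaldTerm (α lam h p : ℝ) (u : ℝ → ℂ) (x : ℝ) (k : ℕ) : ℂ :=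
  (grunwaldWeight α k * Real.exp (-((k - p) * h * lam))) • u (x - (k - p) * h)

/-- The `k`-th term `w_k e^{-(k-p)hλ} u(x + (k-p)h)` of the right shifted Grünwald series. -/
def rightGrunwaldTerm (α lam h p : ℝ) (u : ℝ → ℂ) (x : ℝ) (k : ℕ) : ℂ :=
  (grunwaldWeight α k * Real.exp (-((k - p) * h * lam))) • u (x + (k - p) * h)

/-- The left shifted tempered Grünwald operator `A_{h,p}^{α,λ}`. -/
def leftGrunwald (α lam h p : ℝ) (u : ℝ → ℂ) (x : ℝ) : ℂ :=
  (1 / h ^ α) • (∑' k : ℕ, leftGrunwaldTerm α lam h p u x k)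
    - (1 / h ^ α * (Real.exp (p * h * lam) * (1 - Real.exp (-(h * lam))) ^ α)) • u x

/-- The right shifted tempered Grünwald operator `B_{h,p}^{α,λ}`. -/
def rightGrunwald (α lam h p : ℝ) (u : ℝ → ℂ) (x : ℝ) : ℂ :=
  (1 / h ^ α) • (∑' k : ℕ, rightGrunwaldTerm α lam h p u x k)
    - (1 / h ^ α * (Real.exp (p * h * lam) * (1 - Real.exp (-(h * lam))) ^ α)) • u x

/-- The left tempered weighted and shifted Grünwald difference operator. -/
def leftWSGD (α lam h : ℝ) {m : ℕ} (p γ : Fin m → ℝ) (u : ℝ → ℂ) (x : ℝ) : ℂ :=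
  ∑ j, γ j • leftGrunwald α lam h (p j) u x

/-- The right tempered weighted and shifted Grünwald difference operator. -/
def rightWSGD (α lam h : ℝ) {m : ℕ} (p γ : Fin m → ℝ) (u : ℝ → ℂ) (x : ℝ) : ℂ :=
  ∑ j, γ j • rightGrunwald α lam h (p j) u x

/-- The coefficients of the linear systems (one for each equation `i = 0, …, 4`). -/
def wsgdCoeff (α p : ℝ) : Fin 5 → ℝ :=
  ![1,
    p - α / 2,
    p ^ 2 / 2 - α * p / 2 + α / 6 + α * (α - 1) / 8,
    p ^ 3 / 6 - α * p ^ 2 / 4 + (α / 6 + α * (α - 1) / 8) * p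
      - α / 24 - α * (α - 1) / 12 - α * (α - 1) * (α - 2) / 48,
    p ^ 4 / 24 - α * p ^ 3 / 12 + 1 / 2 * (α / 6 + α * (α - 1) / 8) * p ^ 2
      + (-(α / 24) - α * (α - 1) / 12 - α * (α - 1) * (α - 2) / 48) * p
      + α / 120 + 5 * α * (α - 1) / 144 + α * (α - 1) * (α - 2) / 48
      + α * (α - 1) * (α - 2) * (α - 3) / 384]

/-- The linear system for accuracy `ℓ` (`2 ≤ ℓ ≤ 5`), consisting of its first `ℓ` equations:
`∑ γ_j = 1`, and `∑ γ_j c_i(p_j) = 0` for `1 ≤ i < ℓ`. -/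
def WSGDSystem (α : ℝ) (ℓ : ℕ) {m : ℕ} (p γ : Fin m → ℝ) : Prop :=
  ∀ i : Fin 5, (i : ℕ) < ℓ → ∑ j, γ j * wsgdCoeff α (p j) i = if i = 0 then 1 else 0

end

/-! Put a = λ + 2πiω and let û be the Fourier transform of u. On the Fourier side the left tempered
derivative of order β multiplies û by a^β. The Grünwald series with shift p multiplies û by
e^{pah}(1 - e^{-ah})^α, by the binomial series at e^{-ah}. The quotient e^{pz}((1 - e^{-z})/z)^α
expands near 0 as Σ c_i(p) z^i, so the linear system says exactly that the weighted symbol is z^α(1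
+ O(z^ℓ)). On a strip 0 ≤ Re z ≤ R this becomes the global bound C|z|^{ℓ+α} (`symbol_bound`). With z
= ah, the error is at most C h^ℓ ∫ |a|^{ℓ+α}|û| dω, uniformly in x because |e^{ax}| = e^{λx} does
not depend on ω. The scalar subtracted in the Grünwald operator is the same symbol at the real
frequency a = λ, so the same bound compares it with λ^α.

The analytic work is to justify the multiplier a^β from the stated hypotheses. Let s = n - α, in
(0,1), and let g be the Riemann–Liouville integral of order s of e^{λx}u. When λ = 0 the kernel
t^{s-1} is not integrable, and g and its lower derivatives need not have transforms. Their
differences do: one difference makes the kernel integrable, and a difference of a primitive is a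
convolution with an indicator. Computing the transform of an iterated unit difference of g in two
ways and cancelling powers of 1 - e^{-a}, nonzero for non-integer ω, gives the multiplier almost
everywhere (`fourier_iteratedDeriv_leftRLIntegral`).

Integrability of the transform of the derivative of order α + ℓ then makes a^{-s}û integrable, and
with it û and a^{α+ℓ}û. Inversion recovers u, and recovers g up to a constant
(`leftRLIntegral_eq_expIntegral`), which differentiation removes since n ≥ 1. The right-sided case
is the left-sided one for u(-x). -/

noncomputable section

open Filter Topology

/-! ### The bilateral Laplace transform and backward differences -/

/-- The bilateral Laplace transform `∫ e^{-ax} f(x) dx`. -/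
def bilateralLaplace (a : ℂ) (f : ℝ → ℂ) : ℂ := ∫ x : ℝ, Complex.exp (-(a * x)) * f x

/-- Absolute convergence of the bilateral Laplace transform. -/
def LaplaceIntegrable (a : ℂ) (f : ℝ → ℂ) : Prop :=
  Integrable fun x : ℝ => Complex.exp (-(a * x)) * f x

/-- The backward difference `f(x) - f(x - h)`. -/
def bwdDiff (h : ℝ) (f : ℝ → ℂ) (x : ℝ) : ℂ := f x - f (x - h)

theorem exp_mul_comp_sub (a : ℂ) (f : ℝ → ℂ) (h x : ℝ) :
    Complex.exp (-(a * x)) * f (x - h) =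
      Complex.exp (-(a * h)) * (Complex.exp (-(a * ((x - h : ℝ) : ℂ))) * f (x - h)) := by
  rw [← mul_assoc, ← Complex.exp_add]
  congr 2
  push_cast
  ring

theorem LaplaceIntegrable.comp_sub {a : ℂ} {f : ℝ → ℂ} (hf : LaplaceIntegrable a f) (h : ℝ) :
    LaplaceIntegrable a fun x => f (x - h) := by
  simp only [LaplaceIntegrable, exp_mul_comp_sub a f h]
  exact (Integrable.comp_sub_right hf h).const_mul _

theorem bilateralLaplace_comp_sub (a : ℂ) (f : ℝ → ℂ) (h : ℝ) :
    bilateralLaplace a (fun x => f (x - h)) = Complex.exp (-(a * h)) * bilateralLaplace a f := by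
  simp only [bilateralLaplace, exp_mul_comp_sub a f h]
  rw [integral_const_mul,
    integral_sub_right_eq_self (fun x : ℝ => Complex.exp (-(a * (x : ℂ))) * f x) h]

theorem LaplaceIntegrable.bwdDiff {a : ℂ} {f : ℝ → ℂ} (hf : LaplaceIntegrable a f) (h : ℝ) :
    LaplaceIntegrable a (bwdDiff h f) := by
  have := Integrable.sub hf (hf.comp_sub h)
  refine this.congr (ae_of_all _ fun x => ?_)
  simp [_root_.bwdDiff, mul_sub]

theorem bilateralLaplace_bwdDiff {a : ℂ} {f : ℝ → ℂ} (hf : LaplaceIntegrable a f) (h : ℝ) :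
    bilateralLaplace a (bwdDiff h f) = (1 - Complex.exp (-(a * h))) * bilateralLaplace a f := by
  rw [sub_mul, one_mul, ← bilateralLaplace_comp_sub, bilateralLaplace, bilateralLaplace,
    bilateralLaplace, ← integral_sub hf (hf.comp_sub h)]
  simp [bwdDiff, mul_sub]

/-- The weight e^{-ax} is a character, so it distributes over the two factors of a convolution; the
transform calculus reduces to convolution in L¹. -/
theorem exp_mul_conv (a : ℂ) (k f H : ℝ → ℂ) (hH : ∀ x, H x = ∫ t, k t * f (x - t)) :
    (fun x : ℝ => Complex.exp (-(a * x)) * H x) =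
      convolution (fun t : ℝ => Complex.exp (-(a * t)) * k t)
        (fun t : ℝ => Complex.exp (-(a * t)) * f t) (ContinuousLinearMap.mul ℝ ℂ) volume := by
  funext x
  rw [hH, convolution_def, ← integral_const_mul]
  congr 1
  funext t
  simp only [ContinuousLinearMap.mul_apply']
  rw [mul_left_comm, exp_mul_comp_sub a f t x]
  ring

theorem LaplaceIntegrable.conv {a : ℂ} {k f H : ℝ → ℂ} (hk : LaplaceIntegrable a k)
    (hf : LaplaceIntegrable a f) (hH : ∀ x, H x = ∫ t, k t * f (x - t)) :
    LaplaceIntegrable a H := by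
  rw [LaplaceIntegrable, exp_mul_conv a k f H hH]
  exact Integrable.integrable_convolution _ hk hf

theorem bilateralLaplace_conv {a : ℂ} {k f H : ℝ → ℂ} (hk : LaplaceIntegrable a k)
    (hf : LaplaceIntegrable a f) (hH : ∀ x, H x = ∫ t, k t * f (x - t)) :
    bilateralLaplace a H = bilateralLaplace a k * bilateralLaplace a f := by
  rw [bilateralLaplace, exp_mul_conv a k f H hH, integral_convolution _ hk hf]
  rfl

/-! ### Primitives -/

/-- `F` is a primitive of the locally integrable function `f`. -/
def IsPrimitive (F f : ℝ → ℂ) : Prop :=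
  ∀ x y : ℝ, IntervalIntegrable f volume x y ∧ F y - F x = ∫ t in x..y, f t

theorem IsPrimitive.bwdDiff {F f : ℝ → ℂ} (hF : IsPrimitive F f) (h : ℝ) :
    IsPrimitive (bwdDiff h F) (bwdDiff h f) := by
  intro x y
  have h₁ : IntervalIntegrable (fun t => f (t - h)) volume x y := by
    simpa using (hF (x - h) (y - h)).1.comp_sub_right h
  refine ⟨(hF x y).1.sub h₁, ?_⟩
  simp only [_root_.bwdDiff]
  rw [intervalIntegral.integral_sub (hF x y).1 h₁, intervalIntegral.integral_comp_sub_right,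
    ← (hF _ _).2, ← (hF _ _).2]
  ring

theorem IsPrimitive.bwdDiff_iterate {F f : ℝ → ℂ} (hF : IsPrimitive F f) (h : ℝ) (i : ℕ) :
    IsPrimitive ((_root_.bwdDiff h)^[i] F) ((_root_.bwdDiff h)^[i] f) := by
  induction i with
  | zero => exact hF
  | succ i ih => simpa only [Function.iterate_succ_apply'] using ih.bwdDiff h

theorem isPrimitive_of_hasDerivAt {F f : ℝ → ℂ} (hF : ∀ x, HasDerivAt F (f x) x)
    (hf : Continuous f) : IsPrimitive F f := fun x y =>
  ⟨hf.intervalIntegrable x y, (intervalIntegral.integral_eq_sub_of_hasDerivAt (fun t _ => hF t)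
    (hf.intervalIntegrable x y)).symm⟩

theorem AbsolutelyContinuousOnInterval.comp_clm {F : ℝ → ℂ} {a b : ℝ}
    (hF : AbsolutelyContinuousOnInterval F a b) (L : ℂ →L[ℝ] ℝ) (hL : ‖L‖ ≤ 1) :
    AbsolutelyContinuousOnInterval (fun t => L (F t)) a b := by
  unfold AbsolutelyContinuousOnInterval at hF ⊢
  refine squeeze_zero (fun E => Finset.sum_nonneg fun _ _ => dist_nonneg)
    (fun E => Finset.sum_le_sum fun i _ => ?_) hF
  rw [dist_eq_norm, ← map_sub, dist_eq_norm]
  exact (L.le_opNorm _).trans (mul_le_of_le_one_left (norm_nonneg _) hL)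

/-- A real functional commutes with the integral, and with the derivative wherever F is
differentiable, which is almost everywhere by bounded variation. Real and imaginary parts thus
reduce to the real fundamental theorem. -/
theorem AbsolutelyContinuousOnInterval.clm_integral_deriv {F : ℝ → ℂ} {a b : ℝ}
    (hF : AbsolutelyContinuousOnInterval F a b) (hf : IntervalIntegrable (deriv F) volume a b)
    (L : ℂ →L[ℝ] ℝ) (hL : ‖L‖ ≤ 1) :
    L (F b - F a) = L (∫ t in a..b, deriv F t) := by
  rw [map_sub, ← (hF.comp_clm L hL).integral_deriv_eq_sub, ← L.intervalIntegral_comp_comm hf]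
  refine intervalIntegral.integral_congr_ae ?_
  filter_upwards [hF.boundedVariationOn.ae_differentiableAt_of_mem_uIcc] with t ht ht'
  exact (L.hasFDerivAt.comp_hasDerivAt t (ht (uIoc_subset_uIcc ht')).hasDerivAt).deriv

theorem isPrimitive_of_absolutelyContinuous {F : ℝ → ℂ}
    (hF : ∀ a b, AbsolutelyContinuousOnInterval F a b)
    (hf : ∀ a b, IntervalIntegrable (deriv F) volume a b) : IsPrimitive F (deriv F) := fun x y =>
  ⟨hf x y, Complex.ext
    ((hF x y).clm_integral_deriv (hf x y) Complex.reCLM Complex.reCLM_norm.le)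
    ((hF x y).clm_integral_deriv (hf x y) Complex.imCLM Complex.imCLM_norm.le)⟩

/-- The identity is kept multiplied by a so that it also covers a = 0. The indicator is the kernel
that turns f into the difference of its primitive. -/
theorem bilateralLaplace_indicator_Ioc (a : ℂ) {h : ℝ} (hh : 0 ≤ h) :
    LaplaceIntegrable a ((Ioc 0 h).indicator 1) ∧
      a * bilateralLaplace a ((Ioc 0 h).indicator 1) = 1 - Complex.exp (-(a * h)) := by
  have he : (fun x : ℝ => Complex.exp (-(a * x)) * (Ioc 0 h).indicator (1 : ℝ → ℂ) x) =
      (Ioc 0 h).indicator fun x : ℝ => Complex.exp (-(a * x)) := by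
    funext x
    by_cases hx : x ∈ Ioc 0 h <;> simp [hx]
  have hc : Continuous fun x : ℝ => Complex.exp (-(a * x)) := by fun_prop
  constructor
  · rw [LaplaceIntegrable, he, integrable_indicator_iff measurableSet_Ioc]
    exact hc.integrableOn_Ioc
  · rw [bilateralLaplace, he, integral_indicator measurableSet_Ioc,
      ← intervalIntegral.integral_of_le hh, ← intervalIntegral.integral_const_mul]
    have hd : ∀ x : ℝ, HasDerivAt (fun x : ℝ => -Complex.exp (-(a * x)))
        (a * Complex.exp (-(a * x))) x := by
      intro x
      have h₁ : HasDerivAt (fun x : ℝ => -(a * (x : ℂ))) (-a) x := by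
        simpa using ((hasDerivAt_id x).ofReal_comp.const_mul a).fun_neg
      refine h₁.cexp.neg.congr_deriv ?_
      ring
    rw [intervalIntegral.integral_eq_sub_of_hasDerivAt (fun x _ => hd x)
      ((continuous_const.mul hc).intervalIntegrable _ _)]
    simp
    ring

/-- The Laplace transform of the difference of a primitive. -/
theorem IsPrimitive.laplace_bwdDiff {F f : ℝ → ℂ} (hF : IsPrimitive F f) {a : ℂ}
    (hf : LaplaceIntegrable a f) {h : ℝ} (hh : 0 ≤ h) :
    LaplaceIntegrable a (_root_.bwdDiff h F) ∧
      a * bilateralLaplace a (_root_.bwdDiff h F) =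
        (1 - Complex.exp (-(a * h))) * bilateralLaplace a f := by
  have hk := bilateralLaplace_indicator_Ioc a hh
  have hH : ∀ x, _root_.bwdDiff h F x = ∫ t, (Ioc 0 h).indicator (1 : ℝ → ℂ) t * f (x - t) := by
    intro x
    have : (fun t => (Ioc 0 h).indicator (1 : ℝ → ℂ) t * f (x - t)) =
        (Ioc 0 h).indicator fun t => f (x - t) := by
      funext t
      by_cases ht : t ∈ Ioc 0 h <;> simp [ht]
    rw [this, integral_indicator measurableSet_Ioc, ← intervalIntegral.integral_of_le hh,
      intervalIntegral.integral_comp_sub_left, sub_zero, ← (hF _ _).2]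
    rfl
  refine ⟨hk.1.conv hf hH, ?_⟩
  rw [bilateralLaplace_conv hk.1 hf hH, ← mul_assoc, hk.2]

/-! ### The kernel of the Riemann–Liouville integral -/

/-- The kernel `t₊^{s-1}`. -/
def powKernel (s : ℝ) : ℝ → ℂ := (Ioi 0).indicator fun t => ((t ^ (s - 1) : ℝ) : ℂ)

/-- Since s < 1, (1 - h/t)^s ≥ 1 - h/t, so the difference is at most h t^{s-1}. -/
theorem tendsto_rpow_sub_rpow {s h : ℝ} (hs₀ : 0 < s) (hs₁ : s < 1) (hh : 0 < h) :
    Tendsto (fun t : ℝ => t ^ s - (t - h) ^ s) atTop (𝓝 0) := by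
  have h₁ : Tendsto (fun t : ℝ => h * t ^ (-(1 - s))) atTop (𝓝 0) := by
    simpa using (tendsto_rpow_neg_atTop (by linarith : 0 < 1 - s)).const_mul h
  refine tendsto_of_tendsto_of_tendsto_of_le_of_le' tendsto_const_nhds h₁ ?_ ?_
  · filter_upwards [eventually_gt_atTop h] with t ht
    exact sub_nonneg.2 (Real.rpow_le_rpow (by linarith) (by linarith) hs₀.le)
  · filter_upwards [eventually_gt_atTop h] with t ht
    have ht0 : 0 < t := hh.trans ht
    have hq : 0 < 1 - h / t := by rw [sub_pos, div_lt_one ht0]; exact ht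
    have e : t - h = t * (1 - h / t) := by field_simp
    rw [e, Real.mul_rpow ht0.le hq.le]
    have h₂ : 1 - h / t ≤ (1 - h / t) ^ s :=
      Real.self_le_rpow_of_le_one hq.le (by have := div_pos hh ht0; linarith) hs₁.le
    have h₃ : t ^ (-(1 - s)) = t ^ s / t := by
      rw [neg_sub, Real.rpow_sub_one ht0.ne']
    rw [h₃]
    have h₄ : 0 < t ^ s := Real.rpow_pos_of_pos ht0 s
    calc t ^ s - t ^ s * (1 - h / t) ^ s ≤ t ^ s - t ^ s * (1 - h / t) := by gcongr
      _ = h * (t ^ s / t) := by field_simp; ring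

/-- The integrand has constant sign and an explicit primitive that tends to 0, so no decay estimate
on it is needed. -/
theorem integrableOn_rpow_sub_rpow {s h : ℝ} (hs₀ : 0 < s) (hs₁ : s < 1) (hh : 0 < h) :
    IntegrableOn (fun t : ℝ => t ^ (s - 1) - (t - h) ^ (s - 1)) (Ioi h) := by
  refine integrableOn_Ioi_deriv_of_nonpos (g := fun t => s⁻¹ * (t ^ s - (t - h) ^ s))
    (l := 0) ?_ ?_ ?_ ?_
  · refine (Continuous.continuousWithinAt ?_)
    exact continuous_const.mul ((Real.continuous_rpow_const hs₀.le).sub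
      ((Real.continuous_rpow_const hs₀.le).comp (continuous_id.sub continuous_const)))
  · intro t ht
    have ht' : h < t := ht
    have d₁ := (hasDerivAt_id t).rpow_const (p := s) (Or.inl (hh.trans ht').ne')
    have d₂ := ((hasDerivAt_id t).sub_const h).rpow_const (p := s)
      (Or.inl (sub_pos.2 ht').ne')
    refine ((d₁.fun_sub d₂).const_mul s⁻¹).congr_deriv ?_
    simp only [id]
    field_simp
  · intro t ht
    have ht' : h < t := ht
    exact sub_nonpos.2 (Real.rpow_le_rpow_of_nonpos (sub_pos.2 ht') (by linarith) (by linarith))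
  · simpa using (tendsto_rpow_sub_rpow hs₀ hs₁ hh).const_mul s⁻¹

theorem integrable_bwdDiff_powKernel {s h : ℝ} (hs₀ : 0 < s) (hs₁ : s < 1) (hh : 0 < h) :
    Integrable (bwdDiff h (powKernel s)) := by
  have h₁ : IntegrableOn (bwdDiff h (powKernel s)) (Iic 0) := by
    refine integrableOn_zero.congr_fun (fun t ht => ?_) measurableSet_Iic
    have ht' : t ≤ 0 := ht
    simp [bwdDiff, powKernel, ht', show t ≤ h by linarith]
  have h₂ : IntegrableOn (bwdDiff h (powKernel s)) (Ioc 0 h) := by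
    have : IntegrableOn (fun t : ℝ => t ^ (s - 1)) (Ioc 0 h) := by
      rw [← intervalIntegrable_iff_integrableOn_Ioc_of_le hh.le]
      exact intervalIntegral.intervalIntegrable_rpow' (by linarith)
    refine IntegrableOn.congr_fun this.ofReal (fun t ht => ?_) measurableSet_Ioc
    simp [bwdDiff, powKernel, ht.1, ht.2]
  have h₃ : IntegrableOn (bwdDiff h (powKernel s)) (Ioi h) := by
    refine IntegrableOn.congr_fun (integrableOn_rpow_sub_rpow hs₀ hs₁ hh).ofReal
      (fun t ht => ?_) measurableSet_Ioi
    have ht' : h < t := ht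
    simp [bwdDiff, powKernel, ht', hh.trans ht']
  have := (h₁.union h₂).union h₃
  rwa [Iic_union_Ioc_eq_Iic hh.le, Iic_union_Ioi, integrableOn_univ] at this

theorem integrableOn_cpow_mul_exp_neg_mul {s : ℝ} (hs : 0 < s) {a : ℂ} (ha : 0 < a.re) :
    IntegrableOn (fun t : ℝ => (t : ℂ) ^ ((s : ℂ) - 1) * Complex.exp (-(a * t))) (Ioi 0) := by
  have hi : IntegrableOn (fun t : ℝ => t ^ (s - 1) * Real.exp (-a.re * t ^ (1 : ℝ))) (Ioi 0) :=
    integrableOn_rpow_mul_exp_neg_mul_rpow (by linarith) zero_lt_one ha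
  refine hi.mono' ?_ ?_
  · refine ContinuousOn.aestronglyMeasurable (fun t ht => ?_) measurableSet_Ioi
    have ht' : (0 : ℝ) < t := ht
    refine ContinuousAt.continuousWithinAt (ContinuousAt.mul ?_ (by fun_prop))
    exact (Complex.continuousAt_ofReal_cpow_const _ _ (Or.inr ht'.ne'))
  · refine (ae_restrict_iff' measurableSet_Ioi).2 (ae_of_all _ fun t ht => ?_)
    have ht' : (0 : ℝ) < t := ht
    rw [norm_mul, Complex.norm_cpow_eq_rpow_re_of_pos ht', Complex.norm_exp]
    simp

/-- Near a the derivative of the integrand is dominated by t^s e^{-(Re a/2)t}. The resulting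
holomorphy feeds the identity theorem for the Gamma integral. -/
theorem hasDerivAt_integral_cpow_mul_exp_neg_mul {s : ℝ} (hs : 0 < s) {a : ℂ} (ha : 0 < a.re) :
    HasDerivAt (fun a : ℂ => ∫ t : ℝ in Ioi 0, (t : ℂ) ^ ((s : ℂ) - 1) * Complex.exp (-(a * t)))
      (∫ t : ℝ in Ioi 0, (t : ℂ) ^ ((s : ℂ) - 1) * (Complex.exp (-(a * t)) * -t)) a := by
  have hU : {z : ℂ | a.re / 2 < z.re} ∈ 𝓝 a :=
    (isOpen_lt continuous_const Complex.continuous_re).mem_nhds (by simp; linarith)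
  have hb : IntegrableOn (fun t : ℝ => t ^ s * Real.exp (-(a.re / 2) * t ^ (1 : ℝ))) (Ioi 0) :=
    integrableOn_rpow_mul_exp_neg_mul_rpow (by linarith) zero_lt_one (by linarith)
  have hm : AEStronglyMeasurable (fun t : ℝ => (t : ℂ) ^ ((s : ℂ) - 1))
      (volume.restrict (Ioi 0)) := by
    refine ContinuousOn.aestronglyMeasurable (fun t ht => ?_) measurableSet_Ioi
    have ht' : (0 : ℝ) < t := ht
    exact (Complex.continuousAt_ofReal_cpow_const _ _ (Or.inr ht'.ne')).continuousWithinAt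
  refine (hasDerivAt_integral_of_dominated_loc_of_deriv_le (μ := volume.restrict (Ioi 0))
    (F := fun (z : ℂ) (t : ℝ) => (t : ℂ) ^ ((s : ℂ) - 1) * Complex.exp (-(z * t)))
    (F' := fun (z : ℂ) (t : ℝ) => (t : ℂ) ^ ((s : ℂ) - 1) * (Complex.exp (-(z * t)) * -t)) hU ?_
    (integrableOn_cpow_mul_exp_neg_mul hs ha) ?_ ?_ hb ?_).2
  · exact Eventually.of_forall fun z => hm.mul (Continuous.aestronglyMeasurable (by fun_prop))
  · exact hm.mul (Continuous.aestronglyMeasurable (by fun_prop))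
  · refine (ae_restrict_iff' measurableSet_Ioi).2 (ae_of_all _ fun t ht z hz => ?_)
    have ht' : (0 : ℝ) < t := ht
    have hz' : a.re / 2 < z.re := hz
    rw [norm_mul, norm_mul, norm_neg, Complex.norm_cpow_eq_rpow_re_of_pos ht', Complex.norm_exp,
      Complex.norm_real, Real.norm_of_nonneg ht'.le]
    have e1 : t ^ s = t ^ (s - 1) * t := by rw [← Real.rpow_add_one ht'.ne']; simp
    simp only [Complex.sub_re, Complex.ofReal_re, Complex.one_re, Complex.neg_re, Complex.mul_re,
      Complex.ofReal_im, mul_zero, sub_zero, Real.rpow_one]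
    rw [e1, mul_assoc, mul_comm t]
    gcongr
    nlinarith
  · refine ae_of_all _ fun t z _ => HasDerivAt.const_mul _ ?_
    have : HasDerivAt (fun z : ℂ => -(z * (t : ℂ))) (-t) z := by
      simpa using ((hasDerivAt_id z).mul_const (t : ℂ)).fun_neg
    exact this.cexp

theorem integral_cpow_mul_exp_neg_mul_of_re_pos {s : ℝ} (hs : 0 < s) {a : ℂ} (ha : 0 < a.re) :
    ∫ t : ℝ in Ioi 0, (t : ℂ) ^ ((s : ℂ) - 1) * Complex.exp (-(a * t)) =
      Real.Gamma s * a ^ (-s : ℂ) := by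
  have hU : IsOpen {z : ℂ | 0 < z.re} := isOpen_lt continuous_const Complex.continuous_re
  have hF : DifferentiableOn ℂ (fun a : ℂ => ∫ t : ℝ in Ioi 0,
      (t : ℂ) ^ ((s : ℂ) - 1) * Complex.exp (-(a * t))) {z : ℂ | 0 < z.re} := fun z hz =>
    (hasDerivAt_integral_cpow_mul_exp_neg_mul hs hz).differentiableAt.differentiableWithinAt
  have hG : DifferentiableOn ℂ (fun a : ℂ => Real.Gamma s * a ^ (-s : ℂ)) {z : ℂ | 0 < z.re} :=
    fun z hz => (((hasDerivAt_id z).cpow_const (Or.inl hz)).const_mul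
      _).differentiableAt.differentiableWithinAt
  refine AnalyticOnNhd.eqOn_of_preconnected_of_frequently_eq (hF.analyticOnNhd hU)
    (hG.analyticOnNhd hU) (convex_halfSpace_re_gt 0).isPreconnected (z₀ := 1) (by simp) ?_ ha
  -- For real r > 0 the formula is the classical Gamma integral; the reals r > 1 accumulate at 1, so
  -- the identity theorem extends it to the half-plane.
  have hseq : Tendsto (fun r : ℝ => (r : ℂ)) (𝓝[>] 1) (𝓝[≠] 1) := by
    refine tendsto_nhdsWithin_iff.2 ⟨?_, ?_⟩
    · exact (Complex.continuous_ofReal.tendsto' 1 1 (by simp)).mono_left nhdsWithin_le_nhds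
    · filter_upwards [self_mem_nhdsWithin] with r hr
      have hr' : (1 : ℝ) < r := hr
      simpa using hr'.ne'
  refine hseq.frequently (Eventually.frequently ?_)
  filter_upwards [self_mem_nhdsWithin] with r hr
  have hr' : (0 : ℝ) < r := zero_lt_one.trans hr
  rw [Complex.integral_cpow_mul_exp_neg_mul_Ioi (by simpa using hs) hr', Complex.Gamma_ofReal,
    mul_comm, one_div, Complex.inv_cpow, Complex.cpow_neg]
  rw [Complex.arg_ofReal_of_nonneg hr'.le]
  exact Real.pi_pos.ne

theorem laplace_powKernel {s : ℝ} (hs : 0 < s) {a : ℂ} (ha : 0 < a.re) :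
    LaplaceIntegrable a (powKernel s) ∧
      bilateralLaplace a (powKernel s) = Real.Gamma s * a ^ (-s : ℂ) := by
  have e : (fun x : ℝ => Complex.exp (-(a * x)) * powKernel s x) =
      (Ioi 0).indicator fun t : ℝ => (t : ℂ) ^ ((s : ℂ) - 1) * Complex.exp (-(a * t)) := by
    funext t
    by_cases ht : t ∈ Ioi (0 : ℝ)
    · have ht' : (0 : ℝ) < t := ht
      simp only [powKernel, indicator_of_mem ht]
      rw [Complex.ofReal_cpow ht'.le, mul_comm]
      push_cast
      rfl
    · simp [powKernel, indicator_of_notMem ht]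
  constructor
  · rw [LaplaceIntegrable, e, integrable_indicator_iff measurableSet_Ioi]
    exact integrableOn_cpow_mul_exp_neg_mul hs ha
  · rw [bilateralLaplace, e, integral_indicator measurableSet_Ioi,
      integral_cpow_mul_exp_neg_mul_of_re_pos hs ha]

theorem laplaceIntegrable_of_integrable {f : ℝ → ℂ} (hf : Integrable f)
    (h0 : ∀ t ≤ 0, f t = 0) {a : ℂ} (ha : 0 ≤ a.re) : LaplaceIntegrable a f := by
  refine hf.norm.mono' ((Continuous.aestronglyMeasurable (by fun_prop)).mul
    hf.aestronglyMeasurable) (ae_of_all _ fun t => ?_)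
  rcases le_or_gt t 0 with ht | ht
  · simp [h0 t ht]
  · rw [norm_mul, Complex.norm_exp]
    refine mul_le_of_le_one_left (norm_nonneg _) (Real.exp_le_one_iff.2 ?_)
    simp only [Complex.neg_re, Complex.mul_re, Complex.ofReal_re, Complex.ofReal_im, mul_zero,
      sub_zero, Left.neg_nonpos_iff]
    positivity

theorem bwdDiff_powKernel_of_nonpos (s : ℝ) {h t : ℝ} (hh : 0 < h) (ht : t ≤ 0) :
    bwdDiff h (powKernel s) t = 0 := by
  simp [bwdDiff, powKernel, ht, show t ≤ h by linarith]

theorem mem_slitPlane_of_re_nonneg {a : ℂ} (ha : 0 ≤ a.re) (ha0 : a ≠ 0) :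
    a ∈ Complex.slitPlane := by
  rw [Complex.mem_slitPlane_iff]
  by_contra! hc
  exact ha0 (Complex.ext (le_antisymm hc.1 ha) hc.2)

/-- On the imaginary axis, reached when λ = 0, the kernel has no absolutely convergent transform,
but its difference does. The formula is proved at a + ε and ε → 0⁺: dominated convergence on one
side, continuity of the principal power at a ≠ 0 on the other. -/
theorem laplace_bwdDiff_powKernel {s h : ℝ} (hs₀ : 0 < s) (hs₁ : s < 1) (hh : 0 < h) {a : ℂ}
    (ha : 0 ≤ a.re) (ha0 : a ≠ 0) :
    LaplaceIntegrable a (bwdDiff h (powKernel s)) ∧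
      bilateralLaplace a (bwdDiff h (powKernel s)) =
        (1 - Complex.exp (-(a * h))) * (Real.Gamma s * a ^ (-s : ℂ)) := by
  have hi := integrable_bwdDiff_powKernel hs₀ hs₁ hh
  have h0 := fun t => bwdDiff_powKernel_of_nonpos (t := t) s hh
  refine ⟨laplaceIntegrable_of_integrable hi h0 ha, ?_⟩
  have hA : Tendsto (fun ε : ℝ => a + ε) (𝓝[>] 0) (𝓝 a) := by
    have : Continuous fun ε : ℝ => a + ε := by fun_prop
    simpa using (this.tendsto 0).mono_left nhdsWithin_le_nhds
  have hpos : ∀ᶠ ε : ℝ in 𝓝[>] 0, 0 < ε := eventually_mem_nhdsWithin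
  have hL : Tendsto (fun ε : ℝ => bilateralLaplace (a + ε) (bwdDiff h (powKernel s))) (𝓝[>] 0)
      (𝓝 (bilateralLaplace a (bwdDiff h (powKernel s)))) := by
    refine tendsto_integral_filter_of_dominated_convergence
      (fun t => ‖bwdDiff h (powKernel s) t‖) ?_ ?_ hi.norm ?_
    · exact Eventually.of_forall fun ε => (Continuous.aestronglyMeasurable (by fun_prop)).mul
        hi.aestronglyMeasurable
    · filter_upwards [hpos] with ε hε
      refine ae_of_all _ fun t => ?_
      rcases le_or_gt t 0 with ht | ht
      · simp [h0 t ht]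
      · rw [norm_mul, Complex.norm_exp]
        refine mul_le_of_le_one_left (norm_nonneg _) (Real.exp_le_one_iff.2 ?_)
        simp only [Complex.neg_re, Complex.mul_re, Complex.add_re, Complex.ofReal_re,
          Complex.ofReal_im, mul_zero, sub_zero, Left.neg_nonpos_iff]
        positivity
    · refine ae_of_all _ fun t => ?_
      have : Continuous fun z : ℂ => Complex.exp (-(z * t)) * bwdDiff h (powKernel s) t := by
        fun_prop
      exact (this.tendsto a).comp hA
  have hR : Tendsto (fun ε : ℝ => (1 - Complex.exp (-((a + ε) * h))) *
      (Real.Gamma s * (a + ε) ^ (-s : ℂ))) (𝓝[>] 0)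
      (𝓝 ((1 - Complex.exp (-(a * h))) * (Real.Gamma s * a ^ (-s : ℂ)))) := by
    have : ContinuousAt (fun z : ℂ => (1 - Complex.exp (-(z * h))) *
        (Real.Gamma s * z ^ (-s : ℂ))) a := by
      refine ContinuousAt.mul (by fun_prop) (continuousAt_const.mul ?_)
      exact continuousAt_id.cpow continuousAt_const (mem_slitPlane_of_re_nonneg ha ha0)
    exact this.tendsto.comp hA
  refine tendsto_nhds_unique (hL.congr' ?_) hR
  filter_upwards [hpos] with ε hε
  have hk := laplace_powKernel (s := s) (a := a + ε) hs₀ (by simp; linarith)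
  rw [bilateralLaplace_bwdDiff hk.1, hk.2]

/-- The difference of a left Riemann–Liouville integral is a convolution. -/
theorem bwdDiff_leftRLIntegral {s : ℝ} {f : ℝ → ℂ}
    (hf : ∀ x, IntegrableOn (fun ξ => (x - ξ) ^ (s - 1) • f ξ) (Iio x)) (h x : ℝ) :
    bwdDiff h (leftRLIntegral s f) x =
      ∫ t, (((1 / Real.Gamma s : ℝ) : ℂ) * bwdDiff h (powKernel s) t) * f (x - t) := by
  have e : ∀ x : ℝ, (fun ξ => powKernel s (x - ξ) * f ξ) =
      (Iio x).indicator fun ξ => (x - ξ) ^ (s - 1) • f ξ := by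
    intro x
    funext ξ
    by_cases hξ : ξ < x <;> simp [powKernel, hξ]
  have hint : ∀ x : ℝ, Integrable fun t => powKernel s t * f (x - t) := by
    intro x
    have : Integrable fun ξ => powKernel s (x - ξ) * f ξ := by
      rw [e, integrable_indicator_iff measurableSet_Iio]
      exact hf x
    simpa using this.comp_sub_left x
  have hval : ∀ x : ℝ, leftRLIntegral s f x =
      ((1 / Real.Gamma s : ℝ) : ℂ) * ∫ t, powKernel s t * f (x - t) := by
    intro x
    rw [leftRLIntegral, ← integral_indicator measurableSet_Iio, ← e,
      ← integral_sub_left_eq_self (fun ξ => powKernel s (x - ξ) * f ξ) volume x]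
    simp
  have hint' : Integrable fun t => powKernel s (t - h) * f (x - t) := by
    simpa [sub_sub] using (hint (x - h)).comp_sub_right h
  have hshift : ∫ t, powKernel s t * f (x - h - t) = ∫ t, powKernel s (t - h) * f (x - t) := by
    rw [← integral_sub_right_eq_self (fun t => powKernel s t * f (x - h - t)) h]
    simp [sub_sub]
  rw [bwdDiff, hval, hval, hshift, ← mul_sub, ← integral_sub (hint x) hint',
    ← integral_const_mul]
  congr 1
  funext t
  simp only [bwdDiff]
  ring

theorem laplace_bwdDiff_leftRLIntegral {s h : ℝ} (hs₀ : 0 < s) (hs₁ : s < 1) (hh : 0 < h) {a : ℂ}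
    (ha : 0 ≤ a.re) (ha0 : a ≠ 0) {f : ℝ → ℂ}
    (hf : ∀ x, IntegrableOn (fun ξ => (x - ξ) ^ (s - 1) • f ξ) (Iio x))
    (hfa : LaplaceIntegrable a f) :
    LaplaceIntegrable a (bwdDiff h (leftRLIntegral s f)) ∧
      bilateralLaplace a (bwdDiff h (leftRLIntegral s f)) =
        (1 - Complex.exp (-(a * h))) * (a ^ (-s : ℂ) * bilateralLaplace a f) := by
  have hk := laplace_bwdDiff_powKernel hs₀ hs₁ hh ha ha0
  have hk1 : LaplaceIntegrable a fun t => ((1 / Real.Gamma s : ℝ) : ℂ) *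
      bwdDiff h (powKernel s) t := by
    refine (Integrable.const_mul hk.1 ((1 / Real.Gamma s : ℝ) : ℂ)).congr (ae_of_all _ fun t => ?_)
    ring
  have hk2 : bilateralLaplace a (fun t => ((1 / Real.Gamma s : ℝ) : ℂ) *
      bwdDiff h (powKernel s) t) = (1 - Complex.exp (-(a * h))) * a ^ (-s : ℂ) := by
    have hΓ : (Real.Gamma s : ℂ) ≠ 0 := by exact_mod_cast (Real.Gamma_pos_of_pos hs₀).ne'
    simp only [bilateralLaplace, mul_left_comm (Complex.exp _)]
    rw [integral_const_mul, ← bilateralLaplace, hk.2]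
    push_cast
    field_simp
  have hH := fun x => bwdDiff_leftRLIntegral hf h x
  refine ⟨hk1.conv hfa hH, ?_⟩
  rw [bilateralLaplace_conv hk1 hfa hH, hk2, mul_assoc]

/-! ### Fourier transforms of tempered derivatives -/

/-- The complex frequency `λ + 2πiω`. -/
def temperedFreq (lam ω : ℝ) : ℂ := lam + 2 * Real.pi * ω * Complex.I

@[simp]
theorem temperedFreq_re (lam ω : ℝ) : (temperedFreq lam ω).re = lam := by
  simp [temperedFreq]

@[simp]
theorem temperedFreq_im (lam ω : ℝ) : (temperedFreq lam ω).im = 2 * Real.pi * ω := by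
  simp [temperedFreq]

theorem exp_neg_temperedFreq_mul (lam ω x : ℝ) (z : ℂ) :
    Complex.exp (-(temperedFreq lam ω * x)) * z =
      Complex.exp (((-2 * Real.pi * x * ω : ℝ) : ℂ) * Complex.I) * (Real.exp (-lam * x) • z) := by
  rw [Complex.real_smul, Complex.ofReal_exp, ← mul_assoc, ← Complex.exp_add]
  congr 2
  simp only [temperedFreq]
  push_cast
  ring

theorem bilateralLaplace_temperedFreq (lam ω : ℝ) (f : ℝ → ℂ) :
    bilateralLaplace (temperedFreq lam ω) f = 𝓕 (fun x => Real.exp (-lam * x) • f x) ω := by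
  rw [Real.fourier_real_eq_integral_exp_smul]
  simp only [bilateralLaplace, exp_neg_temperedFreq_mul, smul_eq_mul]

theorem laplaceIntegrable_temperedFreq_iff {lam ω : ℝ} {f : ℝ → ℂ} :
    LaplaceIntegrable (temperedFreq lam ω) f ↔
      Integrable fun x => Real.exp (-lam * x) • f x := by
  simp only [LaplaceIntegrable, exp_neg_temperedFreq_mul]
  constructor
  · intro h
    refine (h.bdd_mul (c := 1)
      (f := fun x : ℝ => Complex.exp (((2 * Real.pi * x * ω : ℝ) : ℂ) * Complex.I))
      (Continuous.aestronglyMeasurable (by fun_prop)) (ae_of_all _ fun x => ?_)).congr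
      (ae_of_all _ fun x => ?_)
    · rw [Complex.norm_exp_ofReal_mul_I]
    · simp only
      rw [← mul_assoc, ← Complex.exp_add]
      push_cast
      ring_nf
      simp
  · intro h
    exact h.bdd_mul (c := 1) (Continuous.aestronglyMeasurable (by fun_prop))
      (ae_of_all _ fun x => (Complex.norm_exp_ofReal_mul_I _).le)

theorem exp_smul_expWeight (lam : ℝ) (u : ℝ → ℂ) :
    (fun x => Real.exp (-lam * x) • expWeight lam u x) = u := by
  funext x
  rw [expWeight, smul_smul, ← Real.exp_add]
  simp

/-- Below the top order the next derivative is continuous; absolute continuity is needed only for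
the last step. -/
theorem HasLocallyIntegrableDeriv.isPrimitive {k : ℕ} {g : ℝ → ℂ}
    (hg : HasLocallyIntegrableDeriv k g)
    (hi : ∀ a b, IntervalIntegrable (iteratedDeriv (k + 1) g) volume a b) {i : ℕ} (hik : i ≤ k) :
    IsPrimitive (iteratedDeriv i g) (iteratedDeriv (i + 1) g) := by
  rcases hik.lt_or_eq with h | rfl
  · refine isPrimitive_of_hasDerivAt (fun x => ?_)
      (hg.1.continuous_iteratedDeriv (i + 1) (by exact_mod_cast h))
    rw [iteratedDeriv_succ]
    exact (hg.1.differentiable_iteratedDeriv i (by exact_mod_cast h) x).hasDerivAt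
  · rw [iteratedDeriv_succ] at hi ⊢
    exact isPrimitive_of_absolutelyContinuous hg.2 hi

/-- Each descent to a primitive costs one difference, which restores integrability. Only the top
member G (k + 1) is assumed to have a transform. -/
theorem laplace_bwdDiff_iterate {k : ℕ} {G : ℕ → ℝ → ℂ}
    (hG : ∀ i ≤ k, IsPrimitive (G i) (G (i + 1))) {a : ℂ} (ha : LaplaceIntegrable a (G (k + 1)))
    {i : ℕ} (hi : i ≤ k + 1) :
    LaplaceIntegrable a ((bwdDiff 1)^[i] (G (k + 1 - i))) ∧
      a ^ i * bilateralLaplace a ((bwdDiff 1)^[i] (G (k + 1 - i))) =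
        (1 - Complex.exp (-a)) ^ i * bilateralLaplace a (G (k + 1)) := by
  induction i with
  | zero => simpa using ha
  | succ i ih =>
    have ih := ih (by omega)
    have hp := (hG (k - i) (by omega)).bwdDiff_iterate 1 i
    rw [show k - i + 1 = k + 1 - i by omega] at hp
    have h := hp.laplace_bwdDiff ih.1 zero_le_one
    rw [show k + 1 - (i + 1) = k - i by omega, Function.iterate_succ_apply']
    refine ⟨h.1, ?_⟩
    rw [pow_succ, mul_assoc, h.2, mul_left_comm, ih.2]
    push_cast
    ring_nf

theorem laplace_bwdDiff_iterate_of_integrable {a : ℂ} {f : ℝ → ℂ} (hf : LaplaceIntegrable a f)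
    (i : ℕ) :
    LaplaceIntegrable a ((bwdDiff 1)^[i] f) ∧
      bilateralLaplace a ((bwdDiff 1)^[i] f) =
        (1 - Complex.exp (-a)) ^ i * bilateralLaplace a f := by
  induction i with
  | zero => simpa using hf
  | succ i ih =>
    rw [Function.iterate_succ_apply']
    refine ⟨ih.1.bwdDiff 1, ?_⟩
    rw [bilateralLaplace_bwdDiff ih.1, ih.2]
    push_cast
    ring_nf

/-- Comparing imaginary parts already forces ω to be an integer, whatever λ is. The excluded
frequencies form a null set. -/
theorem exp_neg_temperedFreq_ne_one {lam ω : ℝ} (hω : ∀ n : ℤ, ω ≠ n) :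
    Complex.exp (-temperedFreq lam ω) ≠ 1 := by
  intro h
  obtain ⟨n, hn⟩ := Complex.exp_eq_one_iff.1 h
  have := congrArg Complex.im hn
  simp only [Complex.neg_im, temperedFreq_im, Complex.mul_im, Complex.intCast_re,
    Complex.intCast_im, Complex.mul_re, Complex.re_ofNat, Complex.ofReal_re, Complex.im_ofNat,
    Complex.ofReal_im, Complex.I_re, Complex.I_im] at this
  apply hω (-n)
  have hpi := Real.pi_pos
  push_cast
  have h2 : 2 * Real.pi * (ω + n) = 0 := by linarith
  have h3 := (mul_eq_zero.1 h2).resolve_left (by positivity)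
  linarith

theorem ae_forall_ne_int : ∀ᵐ ω : ℝ, ∀ n : ℤ, ω ≠ n := by
  rw [ae_all_iff]
  intro n
  exact Measure.ae_ne volume (n : ℝ)

theorem temperedFreq_ne_zero {lam ω : ℝ} (hω : ω ≠ 0) : temperedFreq lam ω ≠ 0 := by
  intro h
  have := congrArg Complex.im h
  simp [hω, Real.pi_ne_zero] at this

/-- The Fourier transform of the tempered derivative. -/
theorem fourier_iteratedDeriv_leftRLIntegral {s lam : ℝ} (hs₀ : 0 < s) (hs₁ : s < 1)
    (hlam : 0 ≤ lam) {u : ℝ → ℂ} (hu : Integrable u) {k : ℕ}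
    (hint : ∀ x, IntegrableOn (fun ξ => (x - ξ) ^ (s - 1) • expWeight lam u ξ) (Iio x))
    (hg : HasLocallyIntegrableDeriv k (leftRLIntegral s (expWeight lam u)))
    (hv : Integrable fun x => Real.exp (-lam * x) •
      iteratedDeriv (k + 1) (leftRLIntegral s (expWeight lam u)) x) {ω : ℝ}
    (hω : ∀ n : ℤ, ω ≠ n) :
    𝓕 (fun x => Real.exp (-lam * x) •
        iteratedDeriv (k + 1) (leftRLIntegral s (expWeight lam u)) x) ω =
      temperedFreq lam ω ^ (k + 1) * (temperedFreq lam ω ^ (-s : ℂ) * 𝓕 u ω) := by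
  set g := leftRLIntegral s (expWeight lam u)
  set a := temperedFreq lam ω with ha
  have ha0 : a ≠ 0 := temperedFreq_ne_zero (by simpa using hω 0)
  have hloc : ∀ x y, IntervalIntegrable (iteratedDeriv (k + 1) g) volume x y := by
    intro x y
    have h₁ := hv.intervalIntegrable (a := x) (b := y)
    have h₂ := h₁.continuousOn_smul (f := fun x => Real.exp (lam * x))
      (Continuous.continuousOn (by fun_prop))
    refine h₂.congr fun t _ => ?_
    rw [smul_smul, ← Real.exp_add]
    simp
  have hvL : LaplaceIntegrable a (iteratedDeriv (k + 1) g) :=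
    laplaceIntegrable_temperedFreq_iff.2 hv
  have huL : LaplaceIntegrable a (expWeight lam u) := by
    rw [ha, laplaceIntegrable_temperedFreq_iff, exp_smul_expWeight]
    exact hu
  -- The (k + 1)-st unit difference of g is transformed twice: from its top derivative (`h₁`), and
  -- from the convolution formula for one difference (`h₂`) followed by k more (`h₃`).
  have h₁ := laplace_bwdDiff_iterate (G := fun i => iteratedDeriv i g)
    (fun i hi => hg.isPrimitive hloc hi) hvL le_rfl
  have h₂ := laplace_bwdDiff_leftRLIntegral hs₀ hs₁ zero_lt_one (by rw [ha]; simpa) ha0 hint huL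
  have h₃ := laplace_bwdDiff_iterate_of_integrable h₂.1 k
  have hne : 1 - Complex.exp (-a) ≠ 0 := sub_ne_zero.2 (exp_neg_temperedFreq_ne_one hω).symm
  rw [← bilateralLaplace_temperedFreq, ← ha]
  have hu' : 𝓕 u ω = bilateralLaplace a (expWeight lam u) := by
    rw [ha, bilateralLaplace_temperedFreq, exp_smul_expWeight]
  rw [hu']
  simp only [Nat.sub_self, iteratedDeriv_zero, Function.iterate_succ_apply] at h₁
  refine mul_left_cancel₀ (pow_ne_zero (k + 1) hne) ?_
  rw [← h₁.2, h₃.2, h₂.2]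
  push_cast
  ring_nf

/-! ### Inversion -/

theorem continuous_temperedFreq (lam : ℝ) : Continuous (temperedFreq lam) := by
  unfold temperedFreq
  fun_prop

theorem norm_exp_temperedFreq_mul (lam ω x : ℝ) :
    ‖Complex.exp (temperedFreq lam ω * x)‖ = Real.exp (lam * x) := by
  rw [Complex.norm_exp]
  simp

theorem integrable_exp_temperedFreq_mul {c : ℝ → ℂ} (hc : Integrable c) (lam x : ℝ) :
    Integrable fun ω => Complex.exp (temperedFreq lam ω * x) * c ω :=
  hc.bdd_mul (c := Real.exp (lam * x))
    (((continuous_temperedFreq lam).mul continuous_const).cexp.aestronglyMeasurable)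
    (ae_of_all _ fun ω => (norm_exp_temperedFreq_mul lam ω x).le)

/-- The inverse transform `∫ e^{(λ + 2πiω)x} c(ω) dω`. -/
def expIntegral (lam : ℝ) (c : ℝ → ℂ) (x : ℝ) : ℂ :=
  ∫ ω, Complex.exp (temperedFreq lam ω * x) * c ω

/-- Fourier inversion for the weighted function. The transform is needed only almost everywhere,
which allows formulas that fail at ω = 0. -/
theorem laplace_inversion {lam : ℝ} {G : ℝ → ℂ} (hG : Continuous G)
    (hi : Integrable fun x => Real.exp (-lam * x) • G x) {c : ℝ → ℂ} (hc : Integrable c)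
    (hGc : ∀ᵐ ω, bilateralLaplace (temperedFreq lam ω) G = c ω) (x : ℝ) :
    G x = expIntegral lam c x := by
  simp only [bilateralLaplace_temperedFreq] at hGc
  have hinv : 𝓕⁻ (𝓕 fun x => Real.exp (-lam * x) • G x) x = Real.exp (-lam * x) • G x :=
    congrFun (Continuous.fourierInv_fourier_eq
    (Continuous.smul (by fun_prop : Continuous fun x => Real.exp (-lam * x)) hG) hi
    (hc.congr (hGc.mono fun _ h => h.symm))) x
  have : G x = Real.exp (lam * x) • (Real.exp (-lam * x) • G x) := by
    rw [smul_smul, ← Real.exp_add]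
    simp
  rw [this, ← hinv, Real.fourierInv_eq', expIntegral, ← integral_smul]
  refine integral_congr_ae (hGc.mono fun ω h => ?_)
  simp only [h]
  rw [Complex.real_smul, smul_eq_mul, Complex.ofReal_exp, ← mul_assoc, ← Complex.exp_add]
  congr 2
  simp only [temperedFreq, RCLike.inner_apply, conj_trivial]
  push_cast
  ring

theorem hasDerivAt_expIntegral {lam : ℝ} {c : ℝ → ℂ} (hc : Integrable c)
    (hc' : Integrable fun ω => temperedFreq lam ω * c ω) (x : ℝ) :
    HasDerivAt (expIntegral lam c) (expIntegral lam (fun ω => temperedFreq lam ω * c ω) x) x := by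
  have hU : Metric.ball x 1 ∈ 𝓝 x := Metric.ball_mem_nhds x one_pos
  refine (hasDerivAt_integral_of_dominated_loc_of_deriv_le (μ := volume)
    (F := fun (y : ℝ) (ω : ℝ) => Complex.exp (temperedFreq lam ω * y) * c ω)
    (F' := fun (y : ℝ) (ω : ℝ) => Complex.exp (temperedFreq lam ω * y) * (temperedFreq lam ω * c ω))
    (bound := fun ω => Real.exp (|lam| * (|x| + 1)) * ‖temperedFreq lam ω * c ω‖) hU ?_
    (integrable_exp_temperedFreq_mul hc lam x) ?_ ?_ (hc'.norm.const_mul _) ?_).2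
  · exact Eventually.of_forall fun y => (integrable_exp_temperedFreq_mul hc lam y).1
  · exact (integrable_exp_temperedFreq_mul hc' lam x).1
  · refine ae_of_all _ fun ω y hy => ?_
    rw [norm_mul, norm_exp_temperedFreq_mul]
    have hy' : |y| ≤ |x| + 1 := by
      have := Metric.mem_ball.1 hy
      rw [Real.dist_eq] at this
      linarith [abs_sub_abs_le_abs_sub y x]
    refine mul_le_mul_of_nonneg_right (Real.exp_le_exp.2 ?_) (norm_nonneg _)
    calc lam * y ≤ |lam * y| := le_abs_self _
      _ = |lam| * |y| := abs_mul _ _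
      _ ≤ |lam| * (|x| + 1) := by gcongr
  · refine ae_of_all _ fun ω y _ => ?_
    have h₁ : HasDerivAt (fun y : ℝ => temperedFreq lam ω * (y : ℂ)) (temperedFreq lam ω) y := by
      simpa using (hasDerivAt_id y).ofReal_comp.const_mul (temperedFreq lam ω)
    exact (h₁.cexp.mul_const (c ω)).congr_deriv (by ring)

theorem iteratedDeriv_expIntegral {lam : ℝ} {c : ℝ → ℂ} {M : ℕ}
    (hc : ∀ i ≤ M, Integrable fun ω => temperedFreq lam ω ^ i * c ω) {i : ℕ} (hi : i ≤ M) :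
    iteratedDeriv i (expIntegral lam c) =
      expIntegral lam fun ω => temperedFreq lam ω ^ i * c ω := by
  induction i with
  | zero => simp
  | succ i ih =>
    rw [iteratedDeriv_succ, ih (by omega)]
    funext x
    have h := hc (i + 1) hi
    simp only [pow_succ', mul_assoc] at h ⊢
    exact (hasDerivAt_expIntegral (hc i (by omega)) h x).deriv

theorem integrable_indicator_abs_rpow {s : ℝ} (hs : s < 1) :
    Integrable ((Icc (-1 : ℝ) 1).indicator fun ω => |ω| ^ (-s)) := by
  have h₁ : IntegrableOn (fun t : ℝ => |t| ^ (-s)) (Ioc 0 1) := by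
    have : IntegrableOn (fun t : ℝ => t ^ (-s)) (Ioc 0 1) := by
      rw [← intervalIntegrable_iff_integrableOn_Ioc_of_le zero_le_one]
      exact intervalIntegral.intervalIntegrable_rpow' (by linarith)
    exact this.congr_fun (fun t ht => by simp [abs_of_pos ht.1]) measurableSet_Ioc
  have h₂ := (integrable_indicator_iff measurableSet_Ioc).2 h₁
  refine (h₂.add h₂.comp_neg).congr ?_
  filter_upwards [Measure.ae_ne volume (0 : ℝ)] with t ht
  simp only [Pi.add_apply, indicator_apply, abs_neg, mem_Ioc, mem_Icc]
  rcases ht.lt_or_gt with h | h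
  · rw [if_neg (by grind), zero_add]
    exact if_congr (by grind) rfl rfl
  · rw [if_neg (c := 0 < -t ∧ _) (by grind), add_zero]
    exact if_congr (by grind) rfl rfl

theorem abs_le_norm_temperedFreq (lam ω : ℝ) : |ω| ≤ ‖temperedFreq lam ω‖ := by
  have h := Complex.abs_im_le_norm (temperedFreq lam ω)
  rw [temperedFreq_im, abs_mul, abs_of_pos (by positivity)] at h
  have : 1 ≤ 2 * Real.pi := by linarith [Real.pi_gt_three]
  nlinarith [abs_nonneg ω]

/-- A bounded function whose product with `a^{M-s}` is integrable has an integrable product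
with `a^{-s}`. -/
theorem integrable_cpow_neg_mul {s lam : ℝ} (hs₀ : 0 < s) (hs₁ : s < 1) {U : ℝ → ℂ} {B : ℝ}
    (hUm : AEStronglyMeasurable U) (hUB : ∀ ω, ‖U ω‖ ≤ B) {M : ℕ}
    (hM : Integrable fun ω => temperedFreq lam ω ^ M * (temperedFreq lam ω ^ (-s : ℂ) * U ω)) :
    Integrable fun ω => temperedFreq lam ω ^ (-s : ℂ) * U ω := by
  have hB : 0 ≤ B := (norm_nonneg _).trans (hUB 0)
  have hm : AEStronglyMeasurable fun ω => temperedFreq lam ω ^ (-s : ℂ) * U ω :=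
    ((continuous_temperedFreq lam).measurable.pow_const _).aestronglyMeasurable.mul hUm
  refine (((integrable_indicator_abs_rpow hs₁).const_mul B).add hM.norm).mono' hm ?_
  filter_upwards [Measure.ae_ne volume (0 : ℝ)] with ω hω
  have hpos : 0 < |ω| := abs_pos.2 hω
  have hle := abs_le_norm_temperedFreq lam ω
  simp only [Pi.add_apply]
  -- On [-1, 1] the bound is B|ω|^{-s}, since |a| ≥ |ω| and s > 0. Outside, |a| ≥ 1, so the factor
  -- a^M only increases the norm.
  by_cases h : ω ∈ Icc (-1 : ℝ) 1
  · rw [indicator_of_mem h]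
    have h₁ : ‖temperedFreq lam ω ^ (-s : ℂ)‖ ≤ |ω| ^ (-s) := by
      have := Complex.norm_cpow_real (temperedFreq lam ω) (-s)
      push_cast at this
      rw [this]
      exact Real.rpow_le_rpow_of_nonpos hpos hle (by linarith)
    refine le_add_of_le_of_nonneg ?_ (norm_nonneg _)
    rw [norm_mul, mul_comm B]
    exact mul_le_mul h₁ (hUB ω) (norm_nonneg _) (by positivity)
  · rw [indicator_of_notMem h, mul_zero, zero_add, norm_mul (_ ^ M), norm_pow]
    refine le_mul_of_one_le_left (norm_nonneg _) (one_le_pow₀ (le_trans ?_ hle))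
    by_contra! hc
    exact h (abs_le.1 hc.le)

theorem integrable_pow_mul_of_le {lam : ℝ} {c : ℝ → ℂ} (hc : Integrable c) {M : ℕ}
    (hM : Integrable fun ω => temperedFreq lam ω ^ M * c ω) {i : ℕ} (hi : i ≤ M) :
    Integrable fun ω => temperedFreq lam ω ^ i * c ω := by
  refine (hc.norm.add hM.norm).mono'
    (((continuous_temperedFreq lam).pow i).aestronglyMeasurable.mul hc.1)
    (ae_of_all _ fun ω => ?_)
  simp only [Pi.add_apply, norm_mul, norm_pow]
  rw [← one_add_mul]
  gcongr
  rcases le_or_gt ‖temperedFreq lam ω‖ 1 with h | h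
  · exact (pow_le_one₀ (norm_nonneg _) h).trans (by simp)
  · exact (pow_le_pow_right₀ h.le hi).trans (by simp)

theorem integrable_cpow_mul_of_le {s lam : ℝ} (hs₀ : 0 < s) (hs₁ : s < 1) {c : ℝ → ℂ}
    (hc : Integrable c) (hM : Integrable fun ω => temperedFreq lam ω ^ 1 * c ω) :
    Integrable fun ω => temperedFreq lam ω ^ (s : ℂ) * c ω := by
  refine (hc.norm.add hM.norm).mono'
    (((continuous_temperedFreq lam).measurable.pow_const _).aestronglyMeasurable.mul hc.1)
    (ae_of_all _ fun ω => ?_)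
  simp only [Pi.add_apply, norm_mul, pow_one]
  rw [← one_add_mul, Complex.norm_cpow_real]
  gcongr
  rcases le_or_gt ‖temperedFreq lam ω‖ 1 with h | h
  · exact (Real.rpow_le_one (norm_nonneg _) h hs₀.le).trans (by simp)
  · exact (Real.rpow_le_self_of_one_le h.le hs₁.le).trans (by simp)

/-- A left Riemann–Liouville integral differs from the Fourier integral by a constant. -/
theorem leftRLIntegral_eq_expIntegral {s lam : ℝ} (hs₀ : 0 < s) (hs₁ : s < 1)
    (hlam : 0 ≤ lam) {u : ℝ → ℂ} (hu : Integrable u)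
    (hint : ∀ x, IntegrableOn (fun ξ => (x - ξ) ^ (s - 1) • expWeight lam u ξ) (Iio x))
    (hg : Continuous (leftRLIntegral s (expWeight lam u)))
    (hb : Integrable fun ω => temperedFreq lam ω ^ (-s : ℂ) * 𝓕 u ω) :
    ∃ C : ℂ, leftRLIntegral s (expWeight lam u) =
      fun x => C + expIntegral lam (fun ω => temperedFreq lam ω ^ (-s : ℂ) * 𝓕 u ω) x := by
  set g := leftRLIntegral s (expWeight lam u)
  set b := fun ω => temperedFreq lam ω ^ (-s : ℂ) * 𝓕 u ω
  -- Inversion is not available for g itself, but every difference of g has the integrable transform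
  -- (1 - e^{-ah}) b.
  have key : ∀ h x : ℝ, 0 < h → bwdDiff h g x = bwdDiff h (expIntegral lam b) x := by
    intro h x hh
    have huL : ∀ ω, LaplaceIntegrable (temperedFreq lam ω) (expWeight lam u) := by
      intro ω
      rw [laplaceIntegrable_temperedFreq_iff, exp_smul_expWeight]
      exact hu
    have hL : ∀ ω : ℝ, ω ≠ 0 → _ := fun ω hω => laplace_bwdDiff_leftRLIntegral hs₀ hs₁ hh
      (by simpa) (temperedFreq_ne_zero (lam := lam) hω) hint (huL ω)
    have hc : Integrable fun ω => b ω - Complex.exp (-(temperedFreq lam ω * h)) * b ω := by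
      have := integrable_exp_temperedFreq_mul hb lam (-h)
      simp only [Complex.ofReal_neg, mul_neg] at this
      exact hb.sub this
    have hcont : Continuous (bwdDiff h g) := by
      unfold bwdDiff
      fun_prop
    rw [laplace_inversion hcont (laplaceIntegrable_temperedFreq_iff.1 (hL 1 one_ne_zero).1) hc
      ?_ x]
    · simp only [bwdDiff, expIntegral]
      rw [← integral_sub (integrable_exp_temperedFreq_mul hb lam x)
        (integrable_exp_temperedFreq_mul hb lam (x - h))]
      congr 1
      funext ω
      have e : Complex.exp (temperedFreq lam ω * ((x - h : ℝ) : ℂ)) =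
          Complex.exp (temperedFreq lam ω * x) * Complex.exp (-(temperedFreq lam ω * h)) := by
        rw [← Complex.exp_add]
        congr 1
        push_cast
        ring
      rw [e]
      ring
    · filter_upwards [Measure.ae_ne volume (0 : ℝ)] with ω hω
      rw [(hL ω hω).2, bilateralLaplace_temperedFreq, exp_smul_expWeight]
      simp only [b]
      ring
  -- Equal differences for all steps force g and the Fourier integral to differ by a constant, read
  -- off at 0.
  refine ⟨g 0 - expIntegral lam b 0, funext fun x => ?_⟩
  rcases lt_trichotomy x 0 with hx | rfl | hx
  · have := key (-x) 0 (by linarith)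
    simp only [bwdDiff, sub_neg_eq_add, zero_add] at this
    linear_combination -this
  · ring
  · have := key x x hx
    simp only [bwdDiff, sub_self] at this
    linear_combination this

/-! ### Grünwald weights -/

theorem succ_mul_choose_succ (r : ℝ) (k : ℕ) :
    (k + 1 : ℝ) * Ring.choose r (k + 1) = Ring.choose r k * (r - k) := by
  have h₁ := Ring.descPochhammer_eq_factorial_smul_choose r (k + 1)
  have h₀ := Ring.descPochhammer_eq_factorial_smul_choose r k
  rw [descPochhammer_succ_right, Polynomial.smeval_mul, h₀] at h₁
  simp only [Polynomial.smeval_sub, Polynomial.smeval_X, pow_one, Polynomial.smeval_natCast,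
    pow_zero, nsmul_eq_mul, mul_one, Nat.factorial_succ, Nat.cast_mul, Nat.cast_add,
    Nat.cast_one] at h₁
  have hk : (k.factorial : ℝ) ≠ 0 := by positivity
  refine mul_left_cancel₀ hk ?_
  linear_combination -h₁

theorem grunwaldWeight_succ (α : ℝ) (k : ℕ) :
    (k + 1 : ℝ) * grunwaldWeight α (k + 1) = (k - α) * grunwaldWeight α k := by
  have := succ_mul_choose_succ α k
  rw [grunwaldWeight, grunwaldWeight, pow_succ]
  linear_combination (-1) * (-1) ^ k * this

/-- For k ≥ α the weight recurrence gives α|w_k| = k|w_k| - (k + 1)|w_{k+1}|, so the tail telescopes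
and is bounded by n|w_n|/α. -/
theorem summable_abs_grunwaldWeight {α : ℝ} (hα : 0 < α) :
    Summable fun k => |grunwaldWeight α k| := by
  obtain ⟨n, hn⟩ := exists_nat_ge α
  have hstep : ∀ k : ℕ, n ≤ k → α * |grunwaldWeight α k| =
      k * |grunwaldWeight α k| - (k + 1) * |grunwaldWeight α (k + 1)| := by
    intro k hk
    have hk' : α ≤ k := hn.trans (by exact_mod_cast hk)
    have h := congrArg abs (grunwaldWeight_succ α k)
    rw [abs_mul, abs_mul, abs_of_nonneg (by positivity : (0 : ℝ) ≤ k + 1),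
      abs_of_nonneg (sub_nonneg.2 hk')] at h
    linarith
  have hsum : ∀ N : ℕ, α * ∑ i ∈ Finset.range N, |grunwaldWeight α (i + n)| =
      n * |grunwaldWeight α n| - (N + n : ℕ) * |grunwaldWeight α (N + n)| := by
    intro N
    induction N with
    | zero => simp
    | succ N ih =>
      rw [Finset.sum_range_succ, mul_add, ih, hstep _ (Nat.le_add_left n N)]
      rw [show N + 1 + n = N + n + 1 by omega]
      push_cast
      ring
  rw [← summable_nat_add_iff n]
  refine summable_of_sum_range_le (c := n * |grunwaldWeight α n| / α) (fun _ => abs_nonneg _)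
    fun N => ?_
  rw [le_div_iff₀ hα, mul_comm, hsum]
  have : (0 : ℝ) ≤ (N + n : ℕ) * |grunwaldWeight α (N + n)| := by positivity
  linarith

/-- Summable weights make the series uniformly convergent on the closed disk, so the binomial
identity extends from the open disk by continuity, at z = 1 too because α > 0. The boundary is
needed: |e^{-ah}| = 1 when λ = 0. -/
theorem hasSum_grunwaldWeight {α : ℝ} (hα : 0 < α) {z : ℂ} (hz : ‖z‖ ≤ 1) :
    HasSum (fun k => (grunwaldWeight α k : ℂ) * z ^ k) ((1 - z) ^ (α : ℂ)) := by
  have hw := summable_abs_grunwaldWeight hα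
  have hbd : ∀ (k : ℕ) (z : ℂ), z ∈ Metric.closedBall (0 : ℂ) 1 →
      ‖(grunwaldWeight α k : ℂ) * z ^ k‖ ≤ |grunwaldWeight α k| := by
    intro k z hz
    rw [mem_closedBall_zero_iff] at hz
    rw [norm_mul, Complex.norm_real, Real.norm_eq_abs, norm_pow]
    exact mul_le_of_le_one_right (abs_nonneg _) (pow_le_one₀ (norm_nonneg _) hz)
  have hsum : ∀ z ∈ Metric.closedBall (0 : ℂ) 1,
      Summable fun k => (grunwaldWeight α k : ℂ) * z ^ k := fun z hz =>
    Summable.of_norm_bounded hw fun k => hbd k z hz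
  have hopen : EqOn (fun z : ℂ => ∑' k, (grunwaldWeight α k : ℂ) * z ^ k)
      (fun z => (1 - z) ^ (α : ℂ)) (Metric.ball 0 1) := by
    intro z hz
    have h := (Complex.one_add_cpow_hasFPowerSeriesOnBall_zero (a := (α : ℂ))).hasSum
      (y := -z) (by simpa [enorm_eq_nnnorm, ← NNReal.coe_lt_one] using hz)
    simp only [binomialSeries_apply, zero_add] at h
    rw [← sub_eq_add_neg] at h
    refine HasSum.tsum_eq (h.congr_fun ?_)
    intro k
    simp [grunwaldWeight, neg_pow z, Complex.ofReal_choose]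
    ring
  have hclosed : EqOn (fun z : ℂ => ∑' k, (grunwaldWeight α k : ℂ) * z ^ k)
      (fun z => (1 - z) ^ (α : ℂ)) (Metric.closedBall 0 1) := by
    refine hopen.of_subset_closure (continuousOn_tsum (fun k => by fun_prop) hw hbd) ?_
      Metric.ball_subset_closedBall (by rw [closure_ball _ one_ne_zero])
    intro z hz
    rw [mem_closedBall_zero_iff] at hz
    have hre : 0 ≤ (1 - z).re := by
      have := (Complex.re_le_norm z).trans hz
      simp only [Complex.sub_re, Complex.one_re]
      linarith
    exact ContinuousAt.continuousWithinAt (ContinuousAt.comp (f := fun z : ℂ => 1 - z)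
      (g := fun z : ℂ => z ^ (α : ℂ))
      (Complex.continuousAt_cpow_const_of_re_pos (Or.inl hre) (by simpa)) (by fun_prop))
  have hz' : z ∈ Metric.closedBall (0 : ℂ) 1 := by simpa using hz
  have := (hsum z hz').hasSum
  rwa [show ∑' k, (grunwaldWeight α k : ℂ) * z ^ k = (1 - z) ^ (α : ℂ) from hclosed hz'] at this

/-! ### Expansion of the Grünwald symbol -/

/-- `f(z) = c₀ + c₁ z + c₂ z² + c₃ z³ + c₄ z⁴ + O(z⁵)` as `z → 0`, `z ≠ 0`. -/
def HasExpansion (f : ℂ → ℂ) (c₀ c₁ c₂ c₃ c₄ : ℂ) : Prop :=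
  (fun z => f z - (c₀ + c₁ * z + c₂ * z ^ 2 + c₃ * z ^ 3 + c₄ * z ^ 4)) =O[𝓝[≠] 0]
    fun z => z ^ 5

theorem isBigO_one_of_continuous {P : ℂ → ℂ} (hP : Continuous P) :
    P =O[𝓝[≠] 0] fun _ => (1 : ℂ) :=
  ((hP.tendsto 0).mono_left nhdsWithin_le_nhds).isBigO_one ℂ

theorem HasExpansion.isBigO_one {f : ℂ → ℂ} {c₀ c₁ c₂ c₃ c₄ : ℂ}
    (hf : HasExpansion f c₀ c₁ c₂ c₃ c₄) : f =O[𝓝[≠] 0] fun _ => (1 : ℂ) := by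
  have h₁ := hf.trans (isBigO_one_of_continuous (continuous_pow 5))
  have h₂ := isBigO_one_of_continuous (P := fun z : ℂ => c₀ + c₁ * z + c₂ * z ^ 2 + c₃ * z ^ 3 +
    c₄ * z ^ 4) (by fun_prop)
  simpa using h₁.add h₂

theorem HasExpansion.add {f g : ℂ → ℂ} {a₀ a₁ a₂ a₃ a₄ b₀ b₁ b₂ b₃ b₄ : ℂ}
    (hf : HasExpansion f a₀ a₁ a₂ a₃ a₄) (hg : HasExpansion g b₀ b₁ b₂ b₃ b₄) :
    HasExpansion (fun z => f z + g z) (a₀ + b₀) (a₁ + b₁) (a₂ + b₂) (a₃ + b₃) (a₄ + b₄) := by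
  refine (Asymptotics.IsBigO.add hf hg).congr_left fun z => ?_
  ring

theorem HasExpansion.const_mul {f : ℂ → ℂ} {a₀ a₁ a₂ a₃ a₄ : ℂ} (c : ℂ)
    (hf : HasExpansion f a₀ a₁ a₂ a₃ a₄) :
    HasExpansion (fun z => c * f z) (c * a₀) (c * a₁) (c * a₂) (c * a₃) (c * a₄) := by
  refine (Asymptotics.IsBigO.const_mul_left hf c).congr_left fun z => ?_
  ring

theorem hasExpansion_const (c : ℂ) : HasExpansion (fun _ => c) c 0 0 0 0 := by
  refine (Asymptotics.isBigO_zero _ _).congr_left fun z => ?_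
  ring

theorem HasExpansion.sum {ι : Type*} (t : Finset ι) {f : ι → ℂ → ℂ} {c₀ c₁ c₂ c₃ c₄ : ι → ℂ}
    (h : ∀ i ∈ t, HasExpansion (f i) (c₀ i) (c₁ i) (c₂ i) (c₃ i) (c₄ i)) :
    HasExpansion (fun z => ∑ i ∈ t, f i z) (∑ i ∈ t, c₀ i) (∑ i ∈ t, c₁ i) (∑ i ∈ t, c₂ i)
      (∑ i ∈ t, c₃ i) (∑ i ∈ t, c₄ i) := by
  refine (Asymptotics.IsBigO.fun_sum h).congr_left fun z => ?_
  simp only [Finset.sum_sub_distrib, Finset.sum_add_distrib, Finset.sum_mul]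

theorem HasExpansion.mul {f g : ℂ → ℂ} {a₀ a₁ a₂ a₃ a₄ b₀ b₁ b₂ b₃ b₄ : ℂ}
    (hf : HasExpansion f a₀ a₁ a₂ a₃ a₄) (hg : HasExpansion g b₀ b₁ b₂ b₃ b₄) :
    HasExpansion (fun z => f z * g z) (a₀ * b₀) (a₀ * b₁ + a₁ * b₀)
      (a₀ * b₂ + a₁ * b₁ + a₂ * b₀) (a₀ * b₃ + a₁ * b₂ + a₂ * b₁ + a₃ * b₀)
      (a₀ * b₄ + a₁ * b₃ + a₂ * b₂ + a₃ * b₁ + a₄ * b₀) := by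
  have h₁ := hf.isBigO_one.mul hg
  have h₂ := Asymptotics.IsBigO.mul hf (isBigO_one_of_continuous (P := fun z : ℂ =>
    b₀ + b₁ * z + b₂ * z ^ 2 + b₃ * z ^ 3 + b₄ * z ^ 4) (by fun_prop))
  -- These are the coefficients of z⁵ to z⁸ in the product of the two quartic polynomials.
  have h₃ := (Asymptotics.isBigO_refl (fun z : ℂ => z ^ 5) (𝓝[≠] 0)).mul
    (isBigO_one_of_continuous (P := fun z : ℂ => (a₁ * b₄ + a₂ * b₃ + a₃ * b₂ + a₄ * b₁) +
      (a₂ * b₄ + a₃ * b₃ + a₄ * b₂) * z + (a₃ * b₄ + a₄ * b₃) * z ^ 2 + a₄ * b₄ * z ^ 3)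
      (by fun_prop))
  simp only [one_mul, mul_one] at h₁ h₂ h₃
  refine ((h₁.add h₂).add h₃).congr_left fun z => ?_
  ring

theorem hasExpansion_exp_mul (p : ℂ) :
    HasExpansion (fun z => Complex.exp (p * z)) 1 p (p ^ 2 / 2) (p ^ 3 / 6) (p ^ 4 / 24) := by
  have ht : Tendsto (fun z : ℂ => p * z) (𝓝[≠] 0) (𝓝 0) := by
    have : Continuous fun z : ℂ => p * z := by fun_prop
    exact (this.tendsto' 0 0 (by simp)).mono_left nhdsWithin_le_nhds
  have h := (Complex.exp_sub_sum_range_isBigO_pow 5).comp_tendsto ht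
  have h' : ((fun x : ℂ => x ^ 5) ∘ fun z => p * z) =O[𝓝[≠] 0] fun z => z ^ 5 := by
    refine ((Asymptotics.isBigO_refl (fun z : ℂ => z ^ 5) _).const_mul_left (p ^ 5)).congr_left
      fun z => ?_
    simp [mul_pow]
  refine (h.trans h').congr_left fun z => ?_
  simp only [Function.comp_apply, Finset.sum_range_succ, Finset.sum_range_zero, Nat.factorial]
  push_cast
  ring

theorem hasExpansion_one_sub_exp_neg_div :
    HasExpansion (fun z => (1 - Complex.exp (-z)) / z) 1 (-1 / 2) (1 / 6) (-1 / 24) (1 / 120) := by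
  have ht : Tendsto (fun z : ℂ => -z) (𝓝[≠] 0) (𝓝 0) :=
    (continuous_neg.tendsto' (0 : ℂ) 0 (by simp)).mono_left nhdsWithin_le_nhds
  -- Order 6, because division by z loses one power.
  have h := (Complex.exp_sub_sum_range_isBigO_pow 6).comp_tendsto ht
  have h₂ := h.mul (Asymptotics.isBigO_refl (fun z : ℂ => z⁻¹) (𝓝[≠] 0)).neg_left
  refine h₂.congr' ?_ ?_
  · filter_upwards [self_mem_nhdsWithin] with z hz
    have hz' : z ≠ 0 := hz
    simp only [Function.comp_apply, Finset.sum_range_succ, Finset.sum_range_zero, Nat.factorial]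
    push_cast
    field_simp
    ring
  · filter_upwards [self_mem_nhdsWithin] with z hz
    have hz' : z ≠ 0 := hz
    simp only [Function.comp_apply]
    field_simp

theorem ring_choose_values (α : ℝ) :
    (Ring.choose α 0 = 1 ∧ Ring.choose α 1 = α ∧ Ring.choose α 2 = α * (α - 1) / 2) ∧
      Ring.choose α 3 = α * (α - 1) * (α - 2) / 6 ∧
      Ring.choose α 4 = α * (α - 1) * (α - 2) * (α - 3) / 24 := by
  have h0 : Ring.choose α 0 = 1 := by simp
  have h1 := succ_mul_choose_succ α 0
  have h2 := succ_mul_choose_succ α 1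
  have h3 := succ_mul_choose_succ α 2
  have h4 := succ_mul_choose_succ α 3
  norm_num at h1 h2 h3 h4
  refine ⟨⟨h0, ?_, ?_⟩, ?_, ?_⟩
  · simp
  · linarith
  · have : Ring.choose α 2 = α * (α - 1) / 2 := by linarith
    rw [this] at h3
    linarith
  · have h2' : Ring.choose α 2 = α * (α - 1) / 2 := by linarith
    rw [h2'] at h3
    have h3' : Ring.choose α 3 = α * (α - 1) * (α - 2) / 6 := by linarith
    rw [h3'] at h4
    linarith

theorem HasExpansion.tendsto_zero {y : ℂ → ℂ} {c₁ c₂ c₃ c₄ : ℂ}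
    (hy : HasExpansion y 0 c₁ c₂ c₃ c₄) :
    Tendsto y (𝓝[≠] 0) (𝓝 0) ∧ y =O[𝓝[≠] 0] fun z => z := by
  have h₁ : (fun z : ℂ => z ^ 5) =O[𝓝[≠] 0] fun z => z := by
    have := (Asymptotics.isBigO_refl (fun z : ℂ => z) (𝓝[≠] 0)).mul
      (isBigO_one_of_continuous (P := fun z : ℂ => z ^ 4) (by fun_prop))
    refine (this.congr_right fun z => mul_one _).congr_left fun z => ?_
    ring
  have h₂ := (Asymptotics.isBigO_refl (fun z : ℂ => z) (𝓝[≠] 0)).mul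
    (isBigO_one_of_continuous (P := fun z : ℂ => c₁ + c₂ * z + c₃ * z ^ 2 + c₄ * z ^ 3)
      (by fun_prop))
  simp only [mul_one] at h₂
  have h₃ : y =O[𝓝[≠] 0] fun z => z := by
    refine ((hy.trans h₁).add h₂).congr_left fun z => ?_
    ring
  exact ⟨h₃.trans_tendsto (tendsto_id.mono_left nhdsWithin_le_nhds), h₃⟩

/-- The quartic Taylor polynomial of (1 + y)^α is substituted; its remainder O(y⁵) is O(z⁵) because
y has no constant term. -/
theorem HasExpansion.one_add_cpow (α : ℝ) {y : ℂ → ℂ} {c₁ c₂ c₃ c₄ : ℂ}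
    (hy : HasExpansion y 0 c₁ c₂ c₃ c₄) :
    HasExpansion (fun z => (1 + y z) ^ (α : ℂ)) 1 (α * c₁)
      (α * c₂ + α * (α - 1) / 2 * c₁ ^ 2)
      (α * c₃ + α * (α - 1) * (c₁ * c₂) + α * (α - 1) * (α - 2) / 6 * c₁ ^ 3)
      (α * c₄ + α * (α - 1) / 2 * (c₂ ^ 2 + 2 * c₁ * c₃) +
        α * (α - 1) * (α - 2) / 2 * (c₁ ^ 2 * c₂) +
        α * (α - 1) * (α - 2) * (α - 3) / 24 * c₁ ^ 4) := by
  obtain ⟨ht, hO⟩ := hy.tendsto_zero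
  have h := ((Complex.one_add_cpow_hasFPowerSeriesAt_zero
    (a := (α : ℂ))).isBigO_sub_partialSum_pow 5).comp_tendsto ht
  have h5 : ((fun y : ℂ => ‖y‖ ^ 5) ∘ y) =O[𝓝[≠] 0] fun z => z ^ 5 :=
    ((hO.pow 5).norm_left).congr_left fun z => by simp
  obtain ⟨⟨e0, e1, e2⟩, e3, e4⟩ := ring_choose_values α
  have hR : (fun z => (1 + y z) ^ (α : ℂ) - (1 + α * y z + α * (α - 1) / 2 * (y z * y z) +
      α * (α - 1) * (α - 2) / 6 * (y z * (y z * y z)) +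
      α * (α - 1) * (α - 2) * (α - 3) / 24 * ((y z * y z) * (y z * y z)))) =O[𝓝[≠] 0]
      fun z => z ^ 5 := by
    refine (h.trans h5).congr_left fun z => ?_
    simp only [Function.comp_apply, FormalMultilinearSeries.partialSum, binomialSeries_apply,
      Finset.sum_range_succ, Finset.sum_range_zero, ← Complex.ofReal_choose, e0, e1, e2, e3, e4,
      List.ofFn_const, List.prod_replicate, smul_eq_mul, zero_add]
    push_cast
    ring
  have h2 := hy.mul hy
  have h3 := hy.mul h2
  have h4 := h2.mul h2
  have hP := ((((hasExpansion_const 1).add (hy.const_mul (α : ℂ))).add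
    (h2.const_mul ((α : ℂ) * (α - 1) / 2))).add
    (h3.const_mul ((α : ℂ) * (α - 1) * (α - 2) / 6))).add
    (h4.const_mul ((α : ℂ) * (α - 1) * (α - 2) * (α - 3) / 24))
  refine (hR.add hP).congr_left fun z => ?_
  ring

/-- The symbol of the shifted Grünwald operator, written with the principal power of a quotient. -/
theorem hasExpansion_symbol (α p : ℝ) :
    HasExpansion (fun z => Complex.exp (p * z) * ((1 - Complex.exp (-z)) / z) ^ (α : ℂ))
      (wsgdCoeff α p 0) (wsgdCoeff α p 1) (wsgdCoeff α p 2) (wsgdCoeff α p 3)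
      (wsgdCoeff α p 4) := by
  have hy := hasExpansion_one_sub_exp_neg_div.add (hasExpansion_const (-1))
  norm_num only at hy
  have h := (hasExpansion_exp_mul p).mul (hy.one_add_cpow α)
  have e : ∀ z : ℂ, 1 + ((1 - Complex.exp (-z)) / z + -1) = (1 - Complex.exp (-z)) / z := by
    intro z
    ring
  simp only [e] at h
  convert h using 1 <;> simp [wsgdCoeff] <;> ring

/-- A monomial of degree below ℓ is removed by an equation of the system; the others are already
O(z^ℓ). -/
theorem isBigO_const_mul_pow {c : ℂ} {i ℓ : ℕ} (h : i < ℓ → c = 0) :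
    (fun z : ℂ => c * z ^ i) =O[𝓝[≠] 0] fun z => z ^ ℓ := by
  rcases lt_or_ge i ℓ with hi | hi
  · simpa [h hi] using Asymptotics.isBigO_zero (fun z : ℂ => z ^ ℓ) (𝓝[≠] 0)
  · have := ((Asymptotics.isBigO_refl (fun z : ℂ => z ^ ℓ) (𝓝[≠] 0)).mul
      (isBigO_one_of_continuous (P := fun z : ℂ => z ^ (i - ℓ)) (by fun_prop))).const_mul_left c
    simp only [mul_one, ← pow_add, Nat.add_sub_cancel' hi] at this
    exact this

theorem isBigO_sum_symbol_sub_one {α : ℝ} {ℓ m : ℕ} (hℓ : 1 ≤ ℓ) (hℓ₂ : ℓ ≤ 5) {p γ : Fin m → ℝ}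
    (hsys : WSGDSystem α ℓ p γ) :
    (fun z : ℂ => (∑ j, (γ j : ℂ) *
      (Complex.exp (p j * z) * ((1 - Complex.exp (-z)) / z) ^ (α : ℂ))) - 1) =O[𝓝[≠] 0]
      fun z => z ^ ℓ := by
  have h := HasExpansion.sum Finset.univ fun j (_ : j ∈ Finset.univ) =>
    (hasExpansion_symbol α (p j)).const_mul (γ j : ℂ)
  have hd : ∀ i : Fin 5, (i : ℕ) < ℓ →
      ∑ j, (γ j : ℂ) * (wsgdCoeff α (p j) i : ℂ) = if i = 0 then 1 else 0 := by
    intro i hi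
    have := congrArg (fun r : ℝ => (r : ℂ)) (hsys i hi)
    simp only [Complex.ofReal_sum, Complex.ofReal_mul] at this
    rw [this]
    split_ifs <;> simp
  have h5 : (fun z : ℂ => z ^ 5) =O[𝓝[≠] 0] fun z => z ^ ℓ := by
    simpa using isBigO_const_mul_pow (c := 1) (i := 5) (ℓ := ℓ) (fun h => absurd h (by omega))
  have h1 := isBigO_const_mul_pow (fun hi => hd 1 hi)
  have h2 := isBigO_const_mul_pow (fun hi => hd 2 hi)
  have h3 := isBigO_const_mul_pow (fun hi => hd 3 hi)
  have h4 := isBigO_const_mul_pow (fun hi => hd 4 hi)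
  have h0 := hd 0 (show 0 < ℓ from hℓ)
  refine (((((h.trans h5).add h1).add h2).add h3).add h4).congr_left fun z => ?_
  rw [h0]
  simp only [if_true, Fin.val_one, pow_one, Fin.val_two, show ((3 : Fin 5) : ℕ) = 3 from rfl,
    show ((4 : Fin 5) : ℕ) = 4 from rfl]
  ring

/-- The arguments satisfy |arg z| ≤ π/2 and |arg q| < π/2, so their sum stays inside (-π, π) and
principal logarithms add. -/
theorem mul_cpow_of_re_nonneg {z q : ℂ} (hz : 0 ≤ z.re) (hz0 : z ≠ 0) (hq : 0 < q.re) (a : ℂ) :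
    (z * q) ^ a = z ^ a * q ^ a := by
  have hq0 : q ≠ 0 := by
    rintro rfl
    simp at hq
  have h₁ := abs_le.1 (Complex.abs_arg_le_pi_div_two_iff.2 hz)
  have h₂ := abs_lt.1 (Complex.abs_arg_lt_pi_div_two_iff.2 (Or.inl hq))
  rw [Complex.cpow_def_of_ne_zero (mul_ne_zero hz0 hq0), Complex.cpow_def_of_ne_zero hz0,
    Complex.cpow_def_of_ne_zero hq0, Complex.log_mul hz0 hq0, add_mul, Complex.exp_add]
  constructor <;> linarith

/-- The symbol `e^{pz}(1 - e^{-z})^α` of the shifted Grünwald series. -/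
def grunwaldSymbol (α p : ℝ) (z : ℂ) : ℂ :=
  Complex.exp (p * z) * (1 - Complex.exp (-z)) ^ (α : ℂ)

/-- Near 0, z^α factors out and the expansion applies. For |z| ≥ r the symbols are bounded on the
strip, and constants are absorbed into powers of |z|/r. The bound on Re z is what controls e^{pz}
for p > 0. -/
theorem symbol_bound {α : ℝ} (hα : 0 < α) {ℓ m : ℕ} (hℓ : 1 ≤ ℓ) (hℓ₂ : ℓ ≤ 5)
    {p γ : Fin m → ℝ} (hsys : WSGDSystem α ℓ p γ) (R : ℝ) :
    ∃ C : ℝ, ∀ z : ℂ, 0 ≤ z.re → z.re ≤ R → z ≠ 0 →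
      ‖(∑ j, (γ j : ℂ) * grunwaldSymbol α (p j) z) - z ^ (α : ℂ)‖ ≤ C * ‖z‖ ^ ℓ * ‖z‖ ^ α := by
  simp only [grunwaldSymbol]
  obtain ⟨C₁, hC₁⟩ := (isBigO_sum_symbol_sub_one hℓ hℓ₂ hsys).bound
  -- The quotient tends to 1; positivity of its real part is what allows the principal power of a
  -- product to split.
  have hq : ∀ᶠ z : ℂ in 𝓝[≠] 0, 0 < ((1 - Complex.exp (-z)) / z).re := by
    have hy := hasExpansion_one_sub_exp_neg_div.add (hasExpansion_const (-1))
    norm_num only at hy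
    have h₁ := hy.tendsto_zero.1.add_const 1
    simp only [neg_add_cancel_right, zero_add] at h₁
    exact ((Complex.continuous_re.tendsto 1).comp h₁).eventually_const_lt (by simp)
  obtain ⟨r, hr, hball⟩ := Metric.mem_nhdsWithin_iff.1 (hC₁.and hq)
  set S := ∑ j, |γ j| * Real.exp (|p j| * R) * 2 ^ α
  refine ⟨max C₁ ((S / r ^ α + 1) / r ^ ℓ), fun z hz hzR hz0 => ?_⟩
  have hzpos : 0 < ‖z‖ := norm_pos_iff.2 hz0
  rcases lt_or_ge ‖z‖ r with hzr | hzr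
  · obtain ⟨hb, hre⟩ := hball ⟨by simpa using hzr, hz0⟩
    have e : (1 - Complex.exp (-z)) ^ (α : ℂ) =
        z ^ (α : ℂ) * ((1 - Complex.exp (-z)) / z) ^ (α : ℂ) := by
      rw [← mul_cpow_of_re_nonneg hz hz0 hre, mul_div_cancel₀ _ hz0]
    have e₂ : (∑ j, (γ j : ℂ) * (Complex.exp (p j * z) * (1 - Complex.exp (-z)) ^ (α : ℂ))) -
        z ^ (α : ℂ) = ((∑ j, (γ j : ℂ) * (Complex.exp (p j * z) *
          ((1 - Complex.exp (-z)) / z) ^ (α : ℂ))) - 1) * z ^ (α : ℂ) := by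
      rw [sub_mul, Finset.sum_mul, one_mul, e]
      congr 1
      refine Finset.sum_congr rfl fun j _ => ?_
      ring
    rw [e₂, norm_mul, Complex.norm_cpow_real]
    rw [norm_pow] at hb
    gcongr
    exact hb.trans (by gcongr; exact le_max_left _ _)
  · have hexp : ‖Complex.exp (-z)‖ ≤ 1 := by
      rw [Complex.norm_exp]
      exact Real.exp_le_one_iff.2 (by simpa using hz)
    have h2 : ‖1 - Complex.exp (-z)‖ ≤ 2 := by
      calc ‖1 - Complex.exp (-z)‖ ≤ ‖(1 : ℂ)‖ + ‖Complex.exp (-z)‖ := norm_sub_le _ _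
        _ ≤ 2 := by rw [norm_one]; linarith
    have hS : ‖∑ j, (γ j : ℂ) * (Complex.exp (p j * z) * (1 - Complex.exp (-z)) ^ (α : ℂ))‖ ≤
        S := by
      refine norm_sum_le_of_le _ fun j _ => ?_
      rw [norm_mul, norm_mul, Complex.norm_real, Real.norm_eq_abs, Complex.norm_cpow_real,
        Complex.norm_exp, mul_assoc]
      gcongr
      simp only [Complex.mul_re, Complex.ofReal_re, Complex.ofReal_im, zero_mul, sub_zero]
      calc p j * z.re ≤ |p j| * z.re := by gcongr; exact le_abs_self _
        _ ≤ |p j| * R := by gcongr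
    have hS0 : 0 ≤ S := (norm_nonneg _).trans hS
    have hrα : (1 : ℝ) ≤ ‖z‖ ^ α / r ^ α := by
      rw [one_le_div (Real.rpow_pos_of_pos hr _)]
      exact Real.rpow_le_rpow hr.le hzr hα.le
    have hrℓ : (1 : ℝ) ≤ ‖z‖ ^ ℓ / r ^ ℓ := by
      rw [one_le_div (pow_pos hr _)]
      gcongr
    calc _ ≤ S + ‖z‖ ^ α := by
          refine (norm_sub_le _ _).trans ?_
          rw [Complex.norm_cpow_real]
          gcongr
      _ ≤ S * (‖z‖ ^ α / r ^ α) + ‖z‖ ^ α := by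
          gcongr
          exact le_mul_of_one_le_right hS0 hrα
      _ = (S / r ^ α + 1) * ‖z‖ ^ α * 1 := by ring
      _ ≤ (S / r ^ α + 1) * ‖z‖ ^ α * (‖z‖ ^ ℓ / r ^ ℓ) := by gcongr
      _ = (S / r ^ α + 1) / r ^ ℓ * ‖z‖ ^ ℓ * ‖z‖ ^ α := by ring
      _ ≤ _ := by
          gcongr
          exact le_max_right _ _

/-! ### Grünwald operators as Fourier integrals -/

theorem expIntegral_sub {lam : ℝ} {c d : ℝ → ℂ} (hc : Integrable c) (hd : Integrable d) (x : ℝ) :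
    expIntegral lam (fun ω => c ω - d ω) x = expIntegral lam c x - expIntegral lam d x := by
  simp only [expIntegral, mul_sub]
  exact integral_sub (integrable_exp_temperedFreq_mul hc lam x)
    (integrable_exp_temperedFreq_mul hd lam x)

theorem expIntegral_sum {ι : Type*} (t : Finset ι) {lam : ℝ} {c : ι → ℝ → ℂ}
    (hc : ∀ i ∈ t, Integrable (c i)) (x : ℝ) :
    expIntegral lam (fun ω => ∑ i ∈ t, c i ω) x = ∑ i ∈ t, expIntegral lam (c i) x := by
  simp only [expIntegral, Finset.mul_sum]
  exact integral_finsetSum t fun i hi => integrable_exp_temperedFreq_mul (hc i hi) lam x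

theorem expIntegral_const_mul (lam : ℝ) (r : ℂ) (c : ℝ → ℂ) (x : ℝ) :
    expIntegral lam (fun ω => r * c ω) x = r * expIntegral lam c x := by
  simp only [expIntegral, mul_left_comm _ r]
  exact integral_const_mul _ _

/-- The modulus e^{λx} of the exponential cancels the prefactor, which makes the bound independent
of x. -/
theorem norm_exp_smul_expIntegral_le {lam : ℝ} {c : ℝ → ℂ} {B : ℝ → ℝ} (hB : Integrable B)
    (h : ∀ᵐ ω, ‖c ω‖ ≤ B ω) (x : ℝ) :
    ‖Real.exp (-lam * x) • expIntegral lam c x‖ ≤ ∫ ω, B ω := by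
  have h₁ : ‖expIntegral lam c x‖ ≤ ∫ ω, Real.exp (lam * x) * B ω := by
    refine norm_integral_le_of_norm_le (hB.const_mul _) (h.mono fun ω hω => ?_)
    rw [norm_mul, norm_exp_temperedFreq_mul]
    gcongr
  rw [integral_const_mul] at h₁
  rw [norm_smul, Real.norm_of_nonneg (Real.exp_pos _).le]
  calc _ ≤ Real.exp (-lam * x) * (Real.exp (lam * x) * ∫ ω, B ω) := by gcongr
    _ = _ := by rw [← mul_assoc, ← Real.exp_add]; simp

theorem norm_exp_neg_le_one {z : ℂ} (hz : 0 ≤ z.re) : ‖Complex.exp (-z)‖ ≤ 1 := by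
  rw [Complex.norm_exp]
  exact Real.exp_le_one_iff.2 (by simpa using hz)

theorem integrable_grunwaldSymbol_mul {α lam h : ℝ} (hα : 0 < α) (hlam : 0 ≤ lam) (hh : 0 < h)
    (p : ℝ) {W : ℝ → ℂ} (hW : Integrable W) :
    Integrable fun ω => grunwaldSymbol α p (temperedFreq lam ω * h) * W ω := by
  have hc := continuous_temperedFreq lam
  have hm : Measurable fun ω => grunwaldSymbol α p (temperedFreq lam ω * h) := by
    unfold grunwaldSymbol
    refine Measurable.mul (Continuous.measurable (by fun_prop)) (Measurable.pow_const ?_ _)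
    exact Continuous.measurable (by fun_prop)
  refine hW.bdd_mul (c := Real.exp (p * (lam * h)) * 2 ^ α) hm.aestronglyMeasurable
    (ae_of_all _ fun ω => ?_)
  have hre : (temperedFreq lam ω * h).re = lam * h := by simp
  rw [grunwaldSymbol, norm_mul, Complex.norm_exp, Complex.norm_cpow_real]
  have h2 : ‖1 - Complex.exp (-(temperedFreq lam ω * h))‖ ≤ 2 := by
    have := norm_exp_neg_le_one (z := temperedFreq lam ω * h) (by rw [hre]; positivity)
    calc _ ≤ ‖(1 : ℂ)‖ + ‖Complex.exp (-(temperedFreq lam ω * h))‖ := norm_sub_le _ _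
      _ ≤ 2 := by rw [norm_one]; linarith
  simp only [Complex.mul_re, Complex.ofReal_re, Complex.ofReal_im, zero_mul, sub_zero, mul_zero,
    temperedFreq_re]
  gcongr

theorem exp_shift_le {lam h : ℝ} (hlam : 0 ≤ lam) (hh : 0 < h) (p : ℝ) (k : ℕ) :
    Real.exp (-((k - p) * h * lam)) ≤ Real.exp (p * h * lam) := by
  rw [Real.exp_le_exp]
  have : (0 : ℝ) ≤ k * h * lam := by positivity
  linarith

theorem summable_leftGrunwaldTerm {α lam h : ℝ} (hα : 0 < α) (hlam : 0 ≤ lam) (hh : 0 < h)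
    (p : ℝ) {u : ℝ → ℂ} {B : ℝ} (hu : ∀ x, ‖u x‖ ≤ B) (x : ℝ) :
    Summable (leftGrunwaldTerm α lam h p u x) := by
  refine Summable.of_norm_bounded
    ((summable_abs_grunwaldWeight hα).mul_right (Real.exp (p * h * lam) * B)) fun k => ?_
  rw [leftGrunwaldTerm, norm_smul, norm_mul, Real.norm_eq_abs, Real.norm_eq_abs, Real.abs_exp,
    mul_assoc]
  gcongr
  · exact Real.exp_le_exp.1 (exp_shift_le hlam hh p k)
  · exact hu _

theorem leftGrunwaldTerm_eq (α lam h p : ℝ) (u : ℝ → ℂ) (x : ℝ) (k : ℕ) :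
    leftGrunwaldTerm α lam h p u x k = Real.exp (-lam * x) •
      ((grunwaldWeight α k : ℂ) * expWeight lam u (x - (k - p) * h)) := by
  simp only [leftGrunwaldTerm, expWeight, Complex.real_smul]
  rw [show -((k - p) * h * lam) = -lam * x + lam * (x - (k - p) * h) by ring, Real.exp_add]
  push_cast
  ring

/-- Translating by -(k - p)h multiplies the transform by e^{pah}(e^{-ah})^k. Summability of the
weights permits exchanging sum and integral, and the binomial series sums the multipliers. -/
theorem tsum_leftGrunwaldTerm {α lam h : ℝ} (hα : 0 < α) (hlam : 0 ≤ lam) (hh : 0 < h)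
    (p : ℝ) {u W : ℝ → ℂ} (hW : Integrable W)
    (huW : ∀ x, expWeight lam u x = expIntegral lam W x) (x : ℝ) :
    ∑' k, leftGrunwaldTerm α lam h p u x k = Real.exp (-lam * x) •
      expIntegral lam (fun ω => grunwaldSymbol α p (temperedFreq lam ω * h) * W ω) x := by
  simp only [leftGrunwaldTerm_eq]
  rw [tsum_const_smul'']
  congr 1
  set F : ℕ → ℝ → ℂ := fun k ω => (grunwaldWeight α k : ℂ) *
    (Complex.exp (temperedFreq lam ω * ((x - (k - p) * h : ℝ) : ℂ)) * W ω)
  have hFi : ∀ k, Integrable (F k) := fun k =>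
    (integrable_exp_temperedFreq_mul hW lam _).const_mul _
  have hFn : ∀ k ω, ‖F k ω‖ =
      |grunwaldWeight α k| * (Real.exp (lam * (x - (k - p) * h)) * ‖W ω‖) := by
    intro k ω
    rw [norm_mul, norm_mul, norm_exp_temperedFreq_mul, Complex.norm_real, Real.norm_eq_abs]
  have hS : Summable fun k => ∫ ω, ‖F k ω‖ := by
    refine Summable.of_nonneg_of_le (fun k => integral_nonneg fun ω => norm_nonneg _) (fun k => ?_)
      ((summable_abs_grunwaldWeight hα).mul_right
        (Real.exp (lam * x) * Real.exp (p * h * lam) * ∫ ω, ‖W ω‖))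
    simp only [hFn]
    rw [integral_const_mul, integral_const_mul]
    have h₁ := exp_shift_le hlam hh p k
    rw [show lam * (x - (k - p) * h) = lam * x + -((k - p) * h * lam) by ring, Real.exp_add]
    have : 0 ≤ ∫ ω, ‖W ω‖ := integral_nonneg fun ω => norm_nonneg _
    gcongr
  have h₁ := (hasSum_integral_of_summable_integral_norm hFi hS).tsum_eq
  have h₂ : ∀ k : ℕ, ∫ ω, F k ω =
      (grunwaldWeight α k : ℂ) * expWeight lam u (x - (k - p) * h) := by
    intro k
    rw [huW, expIntegral, ← integral_const_mul]
  simp only [h₂] at h₁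
  rw [h₁, expIntegral]
  congr 1
  funext ω
  have hz := hasSum_grunwaldWeight hα (z := Complex.exp (-(temperedFreq lam ω * h)))
    (norm_exp_neg_le_one (by simp; positivity))
  have := (hz.mul_left (Complex.exp (temperedFreq lam ω * x) *
    Complex.exp (p * (temperedFreq lam ω * h)))).mul_right (W ω)
  rw [grunwaldSymbol, ← mul_assoc, ← mul_assoc, ← this.tsum_eq]
  congr 1
  funext k
  simp only [F]
  have e : Complex.exp (temperedFreq lam ω * ((x - (k - p) * h : ℝ) : ℂ)) =
      Complex.exp (temperedFreq lam ω * x) * Complex.exp (p * (temperedFreq lam ω * h)) *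
        Complex.exp (-(temperedFreq lam ω * h)) ^ k := by
    rw [← Complex.exp_nat_mul, ← Complex.exp_add, ← Complex.exp_add]
    congr 1
    push_cast
    ring
  rw [e]
  ring

/-- Apply the strip estimate at z = ah and divide by h^α, using (ah)^α = a^α h^α. The condition h <
1 keeps Re(ah) ≤ R. -/
theorem norm_sum_symbol_sub_le {α : ℝ} {ℓ m : ℕ} {p γ : Fin m → ℝ} {C R : ℝ}
    (hC : ∀ z : ℂ, 0 ≤ z.re → z.re ≤ R → z ≠ 0 →
      ‖(∑ j, (γ j : ℂ) * grunwaldSymbol α (p j) z) - z ^ (α : ℂ)‖ ≤ C * ‖z‖ ^ ℓ * ‖z‖ ^ α)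
    {a : ℂ} (ha : 0 ≤ a.re) (haR : a.re ≤ R) (ha0 : a ≠ 0) {h : ℝ} (hh : 0 < h) (hh1 : h < 1) :
    ‖((1 / h ^ α : ℝ) : ℂ) * (∑ j, (γ j : ℂ) * grunwaldSymbol α (p j) (a * h)) - a ^ (α : ℂ)‖ ≤
      C * h ^ ℓ * (‖a‖ ^ ℓ * ‖a‖ ^ α) := by
  have hhα : 0 < h ^ α := Real.rpow_pos_of_pos hh α
  have hre : (a * h).re = a.re * h := by simp
  have h₁ := hC (a * h) (by rw [hre]; positivity)
    (by rw [hre]; exact (mul_le_of_le_one_right ha hh1.le).trans haR)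
    (mul_ne_zero ha0 (by exact_mod_cast hh.ne'))
  rw [mul_cpow_of_re_nonneg ha ha0 (by simpa), ← Complex.ofReal_cpow hh.le, norm_mul,
    Complex.norm_real, Real.norm_of_nonneg hh.le, Real.mul_rpow (norm_nonneg _) hh.le] at h₁
  have e : ((1 / h ^ α : ℝ) : ℂ) * (∑ j, (γ j : ℂ) * grunwaldSymbol α (p j) (a * h)) -
      a ^ (α : ℂ) = ((1 / h ^ α : ℝ) : ℂ) *
        ((∑ j, (γ j : ℂ) * grunwaldSymbol α (p j) (a * h)) - a ^ (α : ℂ) * (h ^ α : ℝ)) := by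
    have : ((h ^ α : ℝ) : ℂ) ≠ 0 := by exact_mod_cast hhα.ne'
    push_cast at this ⊢
    field_simp
  rw [e, norm_mul, Complex.norm_real, Real.norm_of_nonneg (by positivity)]
  calc _ ≤ 1 / h ^ α * (C * (‖a‖ * h) ^ ℓ * (‖a‖ ^ α * h ^ α)) := by gcongr
    _ = _ := by
      rw [mul_pow]
      field_simp

/-- This is the symbol estimate at a = λ. The case λ = 0 is separate, as the estimate excludes z =
0; there both terms vanish because α > 0. -/
theorem abs_sum_real_symbol_sub_le {α : ℝ} (hα : 0 < α) {ℓ m : ℕ} {p γ : Fin m → ℝ} {C lam : ℝ}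
    (hlam : 0 ≤ lam)
    (hC : ∀ z : ℂ, 0 ≤ z.re → z.re ≤ lam → z ≠ 0 →
      ‖(∑ j, (γ j : ℂ) * grunwaldSymbol α (p j) z) - z ^ (α : ℂ)‖ ≤ C * ‖z‖ ^ ℓ * ‖z‖ ^ α)
    {h : ℝ} (hh : 0 < h) (hh1 : h < 1) :
    |(∑ j, γ j * (1 / h ^ α * (Real.exp (p j * h * lam) * (1 - Real.exp (-(h * lam))) ^ α))) -
      lam ^ α| ≤ C * h ^ ℓ * (lam ^ ℓ * lam ^ α) := by
  rcases hlam.eq_or_lt with rfl | hpos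
  · simp [Real.zero_rpow hα.ne']
  · have h₁ := norm_sum_symbol_sub_le hC (a := lam) (by simpa) (by simp)
      (by exact_mod_cast hpos.ne') hh hh1
    rw [Complex.norm_real, Real.norm_of_nonneg hlam] at h₁
    refine le_trans (le_of_eq ?_) h₁
    rw [← Real.norm_eq_abs, ← Complex.norm_real]
    congr 1
    have hb : 0 ≤ 1 - Real.exp (-(h * lam)) := by
      rw [sub_nonneg, Real.exp_le_one_iff]
      have := mul_pos hh hpos
      linarith
    rw [Complex.ofReal_sub, Complex.ofReal_cpow hlam, Complex.ofReal_sum, Finset.mul_sum]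
    congr 1
    refine Finset.sum_congr rfl fun j _ => ?_
    simp only [grunwaldSymbol, Complex.ofReal_mul, Complex.ofReal_cpow hb, Complex.ofReal_sub,
      Complex.ofReal_exp, Complex.ofReal_one, Complex.ofReal_neg]
    rw [mul_comm (lam : ℂ) h, mul_assoc (p j : ℂ)]
    ring

/-- The error estimate, given the Fourier representations of `u` and of its derivative. -/
theorem leftWSGD_error {α lam : ℝ} (hα : 0 < α) (hlam : 0 ≤ lam) {ℓ m : ℕ} (hℓ : 1 ≤ ℓ)
    (hℓ₂ : ℓ ≤ 5) {p γ : Fin m → ℝ} (hsys : WSGDSystem α ℓ p γ) {u W D : ℝ → ℂ}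
    (hW : Integrable W) (huW : ∀ x, expWeight lam u x = expIntegral lam W x) {B : ℝ}
    (hu : ∀ x, ‖u x‖ ≤ B)
    (hWα : Integrable fun ω => temperedFreq lam ω ^ (α : ℂ) * W ω)
    (hWℓ : Integrable fun ω => temperedFreq lam ω ^ ℓ * (temperedFreq lam ω ^ (α : ℂ) * W ω))
    (hD : ∀ x, D x = Real.exp (-lam * x) •
      expIntegral lam (fun ω => temperedFreq lam ω ^ (α : ℂ) * W ω) x) :
    ∃ C : ℝ, ∃ h₀ : ℝ, 0 < h₀ ∧ ∀ h : ℝ, 0 < h → h < h₀ → ∀ x : ℝ,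
      ‖leftWSGD α lam h p γ u x - (D x - (lam ^ α) • u x)‖ ≤ C * h ^ ℓ := by
  obtain ⟨C, hC⟩ := symbol_bound hα hℓ hℓ₂ hsys lam
  refine ⟨C * (∫ ω, ‖temperedFreq lam ω ^ ℓ * (temperedFreq lam ω ^ (α : ℂ) * W ω)‖) +
    C * (lam ^ ℓ * lam ^ α) * B, 1, one_pos, fun h hh hh1 x => ?_⟩
  have hsym := fun j => integrable_grunwaldSymbol_mul hα hlam hh (p j) hW
  set c : ℝ := 1 / h ^ α
  set r : ℝ := (∑ j, γ j * (c * (Real.exp (p j * h * lam) * (1 - Real.exp (-(h * lam))) ^ α))) -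
    lam ^ α
  set E : ℝ → ℂ := fun ω =>
    ((c : ℂ) * (∑ j, (γ j : ℂ) * grunwaldSymbol α (p j) (temperedFreq lam ω * h)) -
      temperedFreq lam ω ^ (α : ℂ)) * W ω
  have hE : expIntegral lam E x =
      (c : ℂ) * ∑ j, (γ j : ℂ) * expIntegral lam
        (fun ω => grunwaldSymbol α (p j) (temperedFreq lam ω * h) * W ω) x -
      expIntegral lam (fun ω => temperedFreq lam ω ^ (α : ℂ) * W ω) x := by
    have hs : Integrable fun ω => ∑ j, (γ j : ℂ) *
        (grunwaldSymbol α (p j) (temperedFreq lam ω * h) * W ω) :=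
      integrable_finsetSum _ fun j _ => (hsym j).const_mul _
    have e : E = fun ω => (c : ℂ) * (∑ j, (γ j : ℂ) *
        (grunwaldSymbol α (p j) (temperedFreq lam ω * h) * W ω)) -
        temperedFreq lam ω ^ (α : ℂ) * W ω := by
      funext ω
      simp only [E, sub_mul, mul_assoc, Finset.sum_mul]
    rw [e, expIntegral_sub (hs.const_mul _) hWα, expIntegral_const_mul,
      expIntegral_sum _ fun j _ => (hsym j).const_mul _]
    simp only [expIntegral_const_mul]
  -- The error splits into the Fourier integral of the symbol error `E` and the scalar error `r`
  -- acting on u.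
  have hmain : leftWSGD α lam h p γ u x - (D x - (lam ^ α) • u x) =
      Real.exp (-lam * x) • expIntegral lam E x - r • u x := by
    rw [hE, hD]
    simp only [leftWSGD, leftGrunwald, tsum_leftGrunwaldTerm hα hlam hh _ hW huW x,
      Complex.real_smul, mul_sub, Finset.sum_sub_distrib, r, Complex.ofReal_sub,
      Complex.ofReal_sum, sub_mul, Finset.sum_mul, Finset.mul_sum]
    rw [show (1 / h ^ α) = c from rfl]
    have e₁ : ∀ j, (γ j : ℂ) * ((c : ℂ) * ((Real.exp (-lam * x) : ℂ) * expIntegral lam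
        (fun ω => grunwaldSymbol α (p j) (temperedFreq lam ω * h) * W ω) x)) =
      (Real.exp (-lam * x) : ℂ) * ((c : ℂ) * ((γ j : ℂ) * expIntegral lam
        (fun ω => grunwaldSymbol α (p j) (temperedFreq lam ω * h) * W ω) x)) := fun j => by ring
    have e₂ : ∀ j, (γ j : ℂ) * (((c * (Real.exp (p j * h * lam) *
        (1 - Real.exp (-(h * lam))) ^ α) : ℝ) : ℂ) * u x) =
      ((γ j * (c * (Real.exp (p j * h * lam) *
        (1 - Real.exp (-(h * lam))) ^ α)) : ℝ) : ℂ) * u x := fun j => by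
      rw [Complex.ofReal_mul (γ j)]
      ring
    simp only [e₁, e₂]
    ring
  have hb₁ : ‖Real.exp (-lam * x) • expIntegral lam E x‖ ≤ ∫ ω, C * h ^ ℓ *
      ‖temperedFreq lam ω ^ ℓ * (temperedFreq lam ω ^ (α : ℂ) * W ω)‖ := by
    refine norm_exp_smul_expIntegral_le (hWℓ.norm.const_mul _) ?_ x
    filter_upwards [Measure.ae_ne volume (0 : ℝ)] with ω hω
    have h₁ := norm_sum_symbol_sub_le hC (a := temperedFreq lam ω) (by simpa) (by simp)
      (temperedFreq_ne_zero hω) hh hh1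
    rw [norm_mul, norm_mul, norm_mul, norm_pow, Complex.norm_cpow_real]
    calc _ ≤ C * h ^ ℓ * (‖temperedFreq lam ω‖ ^ ℓ * ‖temperedFreq lam ω‖ ^ α) * ‖W ω‖ := by
          gcongr
      _ = _ := by ring
  rw [integral_const_mul] at hb₁
  have hb₂ : ‖r • u x‖ ≤ C * h ^ ℓ * (lam ^ ℓ * lam ^ α) * B := by
    rw [norm_smul, Real.norm_eq_abs]
    have h₁ := abs_sum_real_symbol_sub_le hα hlam hC hh hh1
    exact mul_le_mul h₁ (hu x) (norm_nonneg _) ((abs_nonneg _).trans h₁)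
  rw [hmain]
  refine (norm_sub_le _ _).trans ((add_le_add hb₁ hb₂).trans (le_of_eq ?_))
  ring

/-! ### The left-sided theorem -/

theorem floor_add_natCast_of_mem {n : ℕ} {α : ℝ} (hn : 1 ≤ n) (hα₁ : (n : ℝ) - 1 < α)
    (hα₂ : α < n) (ℓ : ℕ) : ⌊α + ℓ⌋₊ = n - 1 + ℓ := by
  have hα : 0 ≤ α := by
    have : (1 : ℝ) ≤ n := by exact_mod_cast hn
    linarith
  rw [Nat.floor_add_natCast hα]
  congr 1
  rw [Nat.floor_eq_iff hα]
  push_cast [hn]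
  constructor <;> linarith

theorem rlDegree_add_natCast {n : ℕ} {α : ℝ} (hn : 1 ≤ n) (hα₁ : (n : ℝ) - 1 < α)
    (hα₂ : α < n) (ℓ : ℕ) : rlDegree (α + ℓ) = n + ℓ := by
  rw [rlDegree, floor_add_natCast_of_mem hn hα₁ hα₂]
  omega

theorem left_main {n : ℕ} (hn : 1 ≤ n) {α lam : ℝ}
    (hα₁ : (n : ℝ) - 1 < α) (hα₂ : α < n) (hlam : 0 ≤ lam)
    {ℓ : ℕ} (hℓ₁ : 1 ≤ ℓ) (hℓ₂ : ℓ ≤ 5) {m : ℕ}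
    {p γ : Fin m → ℝ} (hsys : WSGDSystem α ℓ p γ)
    {u : ℝ → ℂ} (hu : Integrable u) (huc : Continuous u)
    (hex : LeftTemperedDerivExistsAE (α + ℓ) lam u)
    (hv : Integrable (leftTemperedDeriv (α + ℓ) lam u))
    (hFv : Integrable (𝓕 (leftTemperedDeriv (α + ℓ) lam u))) :
    LeftTemperedDerivExists α lam u ∧
      (∀ h : ℝ, 0 < h → ∀ (j : Fin m) (x : ℝ),
        Summable (leftGrunwaldTerm α lam h (p j) u x)) ∧
      ∃ C : ℝ, ∃ h₀ : ℝ, 0 < h₀ ∧ ∀ h : ℝ, 0 < h → h < h₀ → ∀ x : ℝ,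
        ‖leftWSGD α lam h p γ u x - (leftTemperedDeriv α lam u x - (lam ^ α) • u x)‖
          ≤ C * h ^ ℓ := by
  have hn' : (1 : ℝ) ≤ n := by exact_mod_cast hn
  have hα : 0 < α := by linarith
  have hdeg : rlDegree α = n := by simpa using rlDegree_add_natCast hn hα₁ hα₂ 0
  have hdegℓ := rlDegree_add_natCast hn hα₁ hα₂ ℓ
  have hfl := floor_add_natCast_of_mem hn hα₁ hα₂ ℓ
  obtain ⟨s, hs⟩ : ∃ s : ℝ, s = n - α := ⟨_, rfl⟩
  have hs₀ : 0 < s := by linarith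
  have hs₁ : s < 1 := by linarith
  have hsα : (rlDegree α : ℝ) - α = s := by rw [hdeg, hs]
  -- Orders α and α + ℓ share the fractional integral of order s, so the hypotheses at order α + ℓ
  -- concern the very function that is differentiated for order α.
  have hsℓ : (rlDegree (α + ℓ) : ℝ) - (α + ℓ) = s := by rw [hdegℓ, hs]; push_cast; ring
  obtain ⟨hint, hg⟩ := hex
  rw [hsℓ] at hint hg
  rw [hfl] at hg
  have hveq : leftTemperedDeriv (α + ℓ) lam u = fun x => Real.exp (-lam * x) •
      iteratedDeriv (n - 1 + ℓ + 1) (leftRLIntegral s (expWeight lam u)) x := by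
    funext x
    rw [leftTemperedDeriv, leftRLDeriv, hsℓ, hdegℓ, show n - 1 + ℓ + 1 = n + ℓ by omega]
  rw [hveq] at hv hFv
  set a := temperedFreq lam
  set W := 𝓕 u
  set b : ℝ → ℂ := fun ω => a ω ^ (-s : ℂ) * W ω
  have ha0 : ∀ᵐ ω, a ω ≠ 0 := by
    filter_upwards [Measure.ae_ne volume (0 : ℝ)] with ω hω using temperedFreq_ne_zero hω
  have hWb : ∀ ω, ‖W ω‖ ≤ ∫ x, ‖u x‖ := fun ω => VectorFourier.norm_fourierIntegral_le_integral_norm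
    _ _ _ _ ω
  have hWm : Continuous W := VectorFourier.fourierIntegral_continuous Real.continuous_fourierChar
    (by exact continuous_inner) hu
  have hMb : Integrable fun ω => a ω ^ (n - 1 + ℓ + 1) * b ω := by
    refine hFv.congr ?_
    filter_upwards [ae_forall_ne_int] with ω hω
    exact fourier_iteratedDeriv_leftRLIntegral hs₀ hs₁ hlam hu hint hg hv hω
  have hb : Integrable b := integrable_cpow_neg_mul hs₀ hs₁ hWm.aestronglyMeasurable hWb hMb
  have hpow : ∀ i ≤ n - 1 + ℓ + 1, Integrable fun ω => a ω ^ i * b ω := fun i hi =>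
    integrable_pow_mul_of_le hb hMb hi
  -- Here û = a^s b, and |a|^s ≤ 1 + |a| reduces the claim to integrability of b and ab.
  have hW : Integrable W := by
    refine (integrable_cpow_mul_of_le hs₀ hs₁ hb (hpow 1 (by omega))).congr ?_
    filter_upwards [ha0] with ω hω
    simp only [b]
    rw [← mul_assoc, ← Complex.cpow_add _ _ hω]
    simp
  have hcpow : ∀ᵐ ω, a ω ^ n * b ω = a ω ^ (α : ℂ) * W ω := by
    filter_upwards [ha0] with ω hω
    simp only [b]
    rw [← mul_assoc, ← Complex.cpow_natCast, ← Complex.cpow_add _ _ hω, hs]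
    congr 2
    push_cast
    ring
  have huW : ∀ x, expWeight lam u x = expIntegral lam W x := by
    refine laplace_inversion ?_ ?_ hW (ae_of_all _ fun ω => ?_)
    · unfold expWeight
      fun_prop
    · rw [exp_smul_expWeight]
      exact hu
    · rw [bilateralLaplace_temperedFreq, exp_smul_expWeight]
  have hub : ∀ x, ‖u x‖ ≤ ∫ ω, ‖W ω‖ := by
    intro x
    have h := norm_exp_smul_expIntegral_le (lam := lam) hW.norm (ae_of_all _ fun ω => le_rfl) x
    rw [← huW] at h
    rwa [show Real.exp (-lam * x) • expWeight lam u x = u x from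
      congrFun (exp_smul_expWeight lam u) x] at h
  have hWα : Integrable fun ω => a ω ^ (α : ℂ) * W ω := (hpow n (by omega)).congr hcpow
  have hWℓ : Integrable fun ω => a ω ^ ℓ * (a ω ^ (α : ℂ) * W ω) := by
    refine (hpow (ℓ + n) (by omega)).congr (hcpow.mono fun ω hω => ?_)
    simp only
    rw [← hω, pow_add, mul_assoc]
  have hD : ∀ x, leftTemperedDeriv α lam u x = Real.exp (-lam * x) •
      expIntegral lam (fun ω => a ω ^ (α : ℂ) * W ω) x := by
    intro x
    obtain ⟨C, hC⟩ := leftRLIntegral_eq_expIntegral hs₀ hs₁ hlam hu hint hg.1.continuous hb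
    have hd : iteratedDeriv n (leftRLIntegral s (expWeight lam u)) x =
        expIntegral lam (fun ω => a ω ^ n * b ω) x := by
      -- At least one derivative is taken, and the first one removes the additive constant `C`.
      obtain ⟨k, rfl⟩ : ∃ k, n = k + 1 := ⟨n - 1, by omega⟩
      rw [hC, ← iteratedDeriv_expIntegral hpow (by omega), iteratedDeriv_succ', iteratedDeriv_succ']
      congr 1
      funext y
      rw [deriv_const_add]
    rw [leftTemperedDeriv, leftRLDeriv, hsα, hdeg, hd]
    congr 1
    exact integral_congr_ae (hcpow.mono fun ω hω => by simp only [hω])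
  refine ⟨⟨?_, ?_⟩, fun h hh j x => summable_leftGrunwaldTerm hα hlam hh (p j) hub x,
    leftWSGD_error hα hlam hℓ₁ hℓ₂ hsys hW huW hub hWα hWℓ hD⟩
  · rw [hsα]
    exact hint
  · rw [hsα, hdeg]
    exact hg.1.of_le (by exact_mod_cast (by omega : n ≤ n - 1 + ℓ))

/-! ### Reflection -/

theorem rightRLIntegral_eq (s : ℝ) (f : ℝ → ℂ) :
    rightRLIntegral s f = fun x => leftRLIntegral s (fun ξ => f (-ξ)) (-x) := by
  funext x
  rw [rightRLIntegral, leftRLIntegral]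
  congr 1
  rw [← integral_indicator measurableSet_Ioi, ← integral_indicator measurableSet_Iio,
    ← integral_neg_eq_self]
  congr 1
  funext ξ
  simp only [indicator_apply, mem_Ioi, mem_Iio, lt_neg]
  rw [show -ξ - x = -x - ξ by ring]

theorem leftRLIntegral_comp_neg (s : ℝ) (f : ℝ → ℂ) :
    leftRLIntegral s (fun ξ => f (-ξ)) = fun x => rightRLIntegral s f (-x) := by
  funext x
  simp only [rightRLIntegral_eq, neg_neg]

theorem expWeight_comp_neg (lam : ℝ) (u : ℝ → ℂ) :
    expWeight lam (fun x => u (-x)) = fun x => expWeight (-lam) u (-x) := by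
  funext x
  simp [expWeight]

/-- The sign (-1)^N in the right derivative is exactly the one produced by N differentiations of x ↦
-x. -/
theorem leftTemperedDeriv_comp_neg (β lam : ℝ) (u : ℝ → ℂ) (x : ℝ) :
    leftTemperedDeriv β lam (fun y => u (-y)) x = rightTemperedDeriv β lam u (-x) := by
  rw [leftTemperedDeriv, rightTemperedDeriv, leftRLDeriv, rightRLDeriv, expWeight_comp_neg,
    leftRLIntegral_comp_neg, iteratedDeriv_comp_neg]
  simp

theorem integrableOn_comp_neg {s lam x : ℝ} {u : ℝ → ℂ}
    (h : IntegrableOn (fun ξ => (ξ - -x) ^ s • expWeight (-lam) u ξ) (Ioi (-x))) :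
    IntegrableOn (fun ξ => (x - ξ) ^ s • expWeight lam (fun y => u (-y)) ξ) (Iio x) := by
  rw [← integrable_indicator_iff measurableSet_Ioi] at h
  rw [← integrable_indicator_iff measurableSet_Iio]
  refine h.comp_neg.congr (ae_of_all _ fun ξ => ?_)
  simp only [expWeight_comp_neg, indicator_apply, mem_Ioi, mem_Iio, neg_lt_neg_iff]
  rw [show -ξ - -x = x - ξ by ring]

/-- Reflection swaps the open and closed ends, but disjointness of half-open intervals depends only
on their endpoints. -/
theorem disjoint_uIoc_neg {a b c d : ℝ} (h : Disjoint (uIoc a b) (uIoc c d)) :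
    Disjoint (uIoc (-a) (-b)) (uIoc (-c) (-d)) := by
  rw [uIoc, uIoc, Ioc_disjoint_Ioc] at h ⊢
  simp only [max_neg_neg, min_neg_neg] at h ⊢
  exact neg_le_neg h

theorem AbsolutelyContinuousOnInterval.comp_neg {f : ℝ → ℂ}
    (hf : ∀ a b, AbsolutelyContinuousOnInterval f a b) (a b : ℝ) :
    AbsolutelyContinuousOnInterval (fun x => f (-x)) a b := by
  rw [absolutelyContinuousOnInterval_iff]
  intro ε hε
  obtain ⟨δ, hδ, H⟩ := (absolutelyContinuousOnInterval_iff f (-a) (-b)).1 (hf _ _) ε hε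
  refine ⟨δ, hδ, fun E hE hEδ => H (E.1, fun i => (-(E.2 i).1, -(E.2 i).2)) ⟨fun i hi => ?_,
    fun i hi j hj hij => disjoint_uIoc_neg (hE.2 hi hj hij)⟩ (by simpa using hEδ)⟩
  have := hE.1 i hi
  simp only [mem_uIcc] at this ⊢
  constructor <;> grind

theorem HasLocallyIntegrableDeriv.comp_neg {k : ℕ} {g : ℝ → ℂ}
    (hg : HasLocallyIntegrableDeriv k g) : HasLocallyIntegrableDeriv k fun x => g (-x) := by
  refine ⟨hg.1.comp contDiff_neg, fun a b => ?_⟩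
  have : iteratedDeriv k (fun x => g (-x)) = fun x => (-1 : ℝ) ^ k • iteratedDeriv k g (-x) := by
    funext x
    exact iteratedDeriv_comp_neg k g x
  rw [this]
  exact (AbsolutelyContinuousOnInterval.comp_neg hg.2 a b).const_smul _

theorem RightTemperedDerivExistsAE.comp_neg {β lam : ℝ} {u : ℝ → ℂ}
    (h : RightTemperedDerivExistsAE β lam u) :
    LeftTemperedDerivExistsAE β lam fun x => u (-x) := by
  refine ⟨fun x => integrableOn_comp_neg (h.integrable (-x)), ?_⟩
  rw [expWeight_comp_neg, leftRLIntegral_comp_neg]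
  exact h.deriv.comp_neg

theorem rightTemperedDerivExists_of_comp_neg {β lam : ℝ} {u : ℝ → ℂ}
    (hi : ∀ x : ℝ, IntegrableOn
      (fun ξ => (ξ - x) ^ ((rlDegree β - β) - 1) • expWeight (-lam) u ξ) (Ioi x))
    (h : LeftTemperedDerivExists β lam fun x => u (-x)) : RightTemperedDerivExists β lam u := by
  refine ⟨hi, ?_⟩
  have := h.contDiff
  rw [expWeight_comp_neg, leftRLIntegral_comp_neg] at this
  simpa [Function.comp_def] using this.comp contDiff_neg

theorem leftGrunwaldTerm_comp_neg (α lam h p : ℝ) (u : ℝ → ℂ) (x : ℝ) (k : ℕ) :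
    leftGrunwaldTerm α lam h p (fun y => u (-y)) (-x) k = rightGrunwaldTerm α lam h p u x k := by
  rw [leftGrunwaldTerm, rightGrunwaldTerm]
  congr 2
  ring

theorem leftWSGD_comp_neg (α lam h : ℝ) {m : ℕ} (p γ : Fin m → ℝ) (u : ℝ → ℂ) (x : ℝ) :
    leftWSGD α lam h p γ (fun y => u (-y)) (-x) = rightWSGD α lam h p γ u x := by
  simp [leftWSGD, rightWSGD, leftGrunwald, rightGrunwald, leftGrunwaldTerm_comp_neg]

theorem right_main {n : ℕ} (hn : 1 ≤ n) {α lam : ℝ}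
    (hα₁ : (n : ℝ) - 1 < α) (hα₂ : α < n) (hlam : 0 ≤ lam)
    {ℓ : ℕ} (hℓ₁ : 1 ≤ ℓ) (hℓ₂ : ℓ ≤ 5) {m : ℕ}
    {p γ : Fin m → ℝ} (hsys : WSGDSystem α ℓ p γ)
    {u : ℝ → ℂ} (hu : Integrable u) (huc : Continuous u)
    (hex : RightTemperedDerivExistsAE (α + ℓ) lam u)
    (hv : Integrable (rightTemperedDeriv (α + ℓ) lam u))
    (hFv : Integrable (𝓕 (rightTemperedDeriv (α + ℓ) lam u))) :
    RightTemperedDerivExists α lam u ∧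
      (∀ h : ℝ, 0 < h → ∀ (j : Fin m) (x : ℝ),
        Summable (rightGrunwaldTerm α lam h (p j) u x)) ∧
      ∃ C : ℝ, ∃ h₀ : ℝ, 0 < h₀ ∧ ∀ h : ℝ, 0 < h → h < h₀ → ∀ x : ℝ,
        ‖rightWSGD α lam h p γ u x - (rightTemperedDeriv α lam u x - (lam ^ α) • u x)‖
          ≤ C * h ^ ℓ := by
  have hveq : leftTemperedDeriv (α + ℓ) lam (fun y => u (-y)) =
      fun x => rightTemperedDeriv (α + ℓ) lam u (-x) :=
    funext (leftTemperedDeriv_comp_neg (α + ℓ) lam u)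
  have hF : 𝓕 (fun x => rightTemperedDeriv (α + ℓ) lam u (-x)) =
      fun ω => 𝓕 (rightTemperedDeriv (α + ℓ) lam u) (-ω) :=
    funext fun ω => Real.fourier_comp_linearIsometry (LinearIsometryEquiv.neg ℝ (E := ℝ))
      (rightTemperedDeriv (α + ℓ) lam u) ω
  obtain ⟨hE, hS, C, h₀, hh₀, hC⟩ := left_main hn hα₁ hα₂ hlam hℓ₁ hℓ₂ hsys
    hu.comp_neg (huc.comp continuous_neg) hex.comp_neg (by rw [hveq]; exact hv.comp_neg)
    (by rw [hveq, hF]; exact hFv.comp_neg)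
  -- The kernel exponent is the same at both orders, so absolute convergence at order α is inherited
  -- directly from the hypothesis.
  have hdeg : (rlDegree α : ℝ) - α = rlDegree (α + ℓ) - (α + ℓ) := by
    rw [rlDegree_add_natCast hn hα₁ hα₂, show rlDegree α = n by
      simpa using rlDegree_add_natCast hn hα₁ hα₂ 0]
    push_cast
    ring
  refine ⟨rightTemperedDerivExists_of_comp_neg (by rw [hdeg]; exact hex.integrable) hE,
    fun h hh j x => ?_, C, h₀, hh₀, fun h hh hhh x => ?_⟩
  · have := hS h hh j (-x)
    simpa only [funext (leftGrunwaldTerm_comp_neg α lam h (p j) u x)] using this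
  · have := hC h hh hhh (-x)
    simpa only [leftWSGD_comp_neg, leftTemperedDeriv_comp_neg, neg_neg] using this

end

/-- `𝓕` is Mathlib's Fourier transform `∫ e^{-2πi x w} g(x) dx`; integrability of the transform
does not depend on the normalization of the frequency. -/
theorem mainTheorem1 (n : ℕ) (hn : 1 ≤ n) (α lam : ℝ)
    (hα₁ : (n : ℝ) - 1 < α) (hα₂ : α < n) (hlam : 0 ≤ lam)
    (ℓ : ℕ) (hℓ₁ : 2 ≤ ℓ) (hℓ₂ : ℓ ≤ 5) (m : ℕ) (hm : ℓ ≤ m)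
    (p γ : Fin m → ℝ) (hsys : WSGDSystem α ℓ p γ)
    (u : ℝ → ℂ) (hu : Integrable u) (huc : Continuous u) :
    (LeftTemperedDerivExistsAE (α + ℓ) lam u →
      Integrable (leftTemperedDeriv (α + ℓ) lam u) →
      Integrable (𝓕 (leftTemperedDeriv (α + ℓ) lam u)) →
        LeftTemperedDerivExists α lam u ∧
        (∀ h : ℝ, 0 < h → ∀ (j : Fin m) (x : ℝ),
          Summable (leftGrunwaldTerm α lam h (p j) u x)) ∧
        ∃ C : ℝ, ∃ h₀ : ℝ, 0 < h₀ ∧ ∀ h : ℝ, 0 < h → h < h₀ → ∀ x : ℝ,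
          ‖leftWSGD α lam h p γ u x - (leftTemperedDeriv α lam u x - (lam ^ α) • u x)‖
            ≤ C * h ^ ℓ) ∧
    (RightTemperedDerivExistsAE (α + ℓ) lam u →
      Integrable (rightTemperedDeriv (α + ℓ) lam u) →
      Integrable (𝓕 (rightTemperedDeriv (α + ℓ) lam u)) →
        RightTemperedDerivExists α lam u ∧
        (∀ h : ℝ, 0 < h → ∀ (j : Fin m) (x : ℝ),
          Summable (rightGrunwaldTerm α lam h (p j) u x)) ∧
        ∃ C : ℝ, ∃ h₀ : ℝ, 0 < h₀ ∧ ∀ h : ℝ, 0 < h → h < h₀ → ∀ x : ℝ,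
          ‖rightWSGD α lam h p γ u x - (rightTemperedDeriv α lam u x - (lam ^ α) • u x)‖
            ≤ C * h ^ ℓ) := by
  exact ⟨fun hex hv hFv => left_main hn hα₁ hα₂ hlam (by omega) hℓ₂ hsys hu huc hex hv hFv,
    fun hex hv hFv => right_main hn hα₁ hα₂ hlam (by omega) hℓ₂ hsys hu huc hex hv hFv⟩
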